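/- Let $\Omega_1,\dots,\Omega_n\subset\mathbb R^d$ be non-empty convex compact sets, let $r^*$ be the smallest radius of a ball that intersects every $\Omega_i$, and assume $r^*>0$. Let $D$ be the diameter of $\bigcup_i\Omega_i$ and $R=D/r^*$. Let $\mathcal X$ be the convex hull of $\bigcup_i\Omega_i$, let $\mathcal V=\Omega_1\times\dots\times\Omega_n$, and let $$\mathcal Y=\Big\{(y_i,s_i)_{i=1}^n\in(\mathbb R^{d+1})^n:\ \|y_i\|\le s_i\ \text{for all } i,\ \sum_{i=1}^n s_i=1\Big\}.$$ A best response to $(y_i,s_i)_i\in\mathcal Y$ is a minimizer $(x,v_1,\dots,v_n)$ of $\sum_{i=1}^n\langle x-v_i,y_i\rangle$ over $\mathcal X\times\mathcal V$. Suppose that a subroutine computes a best response to every element of $\mathcal Y$ in $O(S)$ time, and let $0<\varepsilon\le 1$. Then there is an iterative algorithm that computes a $(1+\varepsilon)$-approximate solution of the smallest intersecting ball problem, that is, a point $x$ and a number $r\le(1+\varepsilon)r^*$ such that the ball $B(x,r)$ intersects every $\Omega_i$, in time $$O\!\left(\frac{R^2\,(S+nd)\,\log n}{\varepsilon^2}\right)$$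 on a unit-cost random access machine with real arithmetic and square roots. The algorithm is a single program for all $n$, $d$, $\varepsilon$ and all inputs; it receives $n$, $d$, $\varepsilon$ and accesses the sets only by calling the best-response subroutine on elements of $\mathcal Y$; and the centre $x$ that it returns is the average, over a non-empty set of these calls, of the points of $\mathcal X$ that the subroutine returned. The constant in the bound depends only on the constant in the $O(S)$ bound for the subroutine. -/

import Mathlib

namespace SIB

/-! ## The smallest intersecting ball problem and the associated game -/

/-- Points of `d`-dimensional Euclidean space. -/
abbrev Pt (d : ℕ) := EuclideanSpace ℝ (Fin d)

/-- The ambient space of the max-player: `n` vectors `(y i, s i)` of `ℝ^(d+1)`. -/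
abbrev MaxVec (n d : ℕ) := Fin n → Pt d × ℝ

/-- The ambient space of the min-player: vectors `(x, v 1, ..., v n)`. -/
abbrev MinVec (n d : ℕ) := Pt d × (Fin n → Pt d)

/-- The optimal radius: the infimum (attained when the objects are compact and non-empty) of the
radii of the balls that intersect every object. -/
noncomputable def optRadius {n d : ℕ} (Ω : Fin n → Set (Pt d)) : ℝ :=
  sInf {r : ℝ | 0 ≤ r ∧ ∃ x : Pt d, ∀ i, (Metric.closedBall x r ∩ Ω i).Nonempty}

/-- `(x, r)` is a `(1 + ε)`-approximate solution: the ball `B(x, r)` intersects every object, and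
`r` is at most `(1 + ε)` times the optimal radius. -/
def IsApproxSolution {n d : ℕ} (Ω : Fin n → Set (Pt d)) (ε : ℝ) (x : Pt d) (r : ℝ) : Prop :=
  (∀ i, (Metric.closedBall x r ∩ Ω i).Nonempty) ∧ r ≤ (1 + ε) * optRadius Ω

/-- The strategy set of the min-player: the product of the convex hull of the input with the
product of the objects. -/
def minSet {n d : ℕ} (Ω : Fin n → Set (Pt d)) : Set (MinVec n d) :=
  {p | p.1 ∈ convexHull ℝ (⋃ i, Ω i) ∧ ∀ i, p.2 i ∈ Ω i}

/-- The strategy set of the max-player: a product of Euclidean balls whose radii sum to one. -/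
def maxSet (n d : ℕ) : Set (MaxVec n d) :=
  {y | (∀ i, ‖(y i).1‖ ≤ (y i).2) ∧ ∑ i, (y i).2 = 1}

/-- The bilinear objective of the game: the inner product of the concatenation of the vectors
`(x - v i, 0)` with the concatenation of the vectors `(y i, s i)`. -/
noncomputable def payoff {n d : ℕ} (p : MinVec n d) (y : MaxVec n d) : ℝ :=
  ∑ i, (inner ℝ (p.1 - p.2 i) (y i).1 + 0 * (y i).2)

/-- `p` is a best response of the min-player against `y`. -/
def IsBestResponse {n d : ℕ} (Ω : Fin n → Set (Pt d)) (y : MaxVec n d) (p : MinVec n d) : Prop :=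
  p ∈ minSet Ω ∧ ∀ q ∈ minSet Ω, payoff p y ≤ payoff q y

/-! ## A unit-cost RAM over the reals with a best-response subroutine

The memory consists of natural-number cells, used for counters and addresses, and of real cells.
The elementary instructions are loads of constants, addition and truncated subtraction of natural
numbers, the four arithmetic operations and the square root on reals, and indirect loads and
stores. Each of them takes one unit of time, as does each comparison. A program is a fixed finite
text built from instructions and calls by sequencing, branching and looping. -/

/-- Memory contents. -/
structure State where
  nat : ℕ → ℕ
  real : ℕ → ℝ

/-- The binary operations on natural-number cells. -/
inductive NatOp
  | add
  | sub

def NatOp.eval : NatOp → ℕ → ℕ → ℕ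
  | .add => fun a b => a + b
  | .sub => fun a b => a - b

/-- The binary operations on real cells (division by zero returns zero). -/
inductive RealOp
  | add
  | sub
  | mul
  | div

noncomputable def RealOp.eval : RealOp → ℝ → ℝ → ℝ
  | .add => fun a b => a + b
  | .sub => fun a b => a - b
  | .mul => fun a b => a * b
  | .div => fun a b => a / b

/-- Elementary instructions. -/
inductive Instr
  | natConst (a c : ℕ)
  | natOp (o : NatOp) (a b c : ℕ)
  | natLoad (a b : ℕ)
  | natStore (a b : ℕ)
  | realConst (a : ℕ) (c : ℚ)
  | realOp (o : RealOp) (a b c : ℕ)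
  | realSqrt (a b : ℕ)
  | realLoad (a b : ℕ)
  | realStore (a b : ℕ)

/-- The effect of an elementary instruction. -/
noncomputable def Instr.apply : Instr → State → State
  | .natConst a c, σ => ⟨Function.update σ.nat a c, σ.real⟩
  | .natOp o a b c, σ => ⟨Function.update σ.nat a (o.eval (σ.nat b) (σ.nat c)), σ.real⟩
  | .natLoad a b, σ => ⟨Function.update σ.nat a (σ.nat (σ.nat b)), σ.real⟩
  | .natStore a b, σ => ⟨Function.update σ.nat (σ.nat a) (σ.nat b), σ.real⟩
  | .realConst a c, σ => ⟨σ.nat, Function.update σ.real a (c : ℝ)⟩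
  | .realOp o a b c, σ => ⟨σ.nat, Function.update σ.real a (o.eval (σ.real b) (σ.real c))⟩
  | .realSqrt a b, σ => ⟨σ.nat, Function.update σ.real a (Real.sqrt (σ.real b))⟩
  | .realLoad a b, σ => ⟨σ.nat, Function.update σ.real a (σ.real (σ.nat b))⟩
  | .realStore a b, σ => ⟨σ.nat, Function.update σ.real (σ.nat a) (σ.real b)⟩

/-- Comparisons of two cells. -/
inductive Test
  | natLt (a b : ℕ)
  | realLe (a b : ℕ)

def Test.Holds : Test → State → Prop
  | .natLt a b, σ => σ.nat a < σ.nat b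
  | .realLe a b, σ => σ.real a ≤ σ.real b

/-- Programs. `call a b` calls the best-response subroutine on the vector stored in the real cells
from the address held in natural-number cell `a` on, and has its answer written to the real cells
from the address held in natural-number cell `b` on. -/
inductive Prog
  | skip
  | instr (i : Instr)
  | call (a b : ℕ)
  | seq (p q : Prog)
  | branch (c : Test) (p q : Prog)
  | loop (c : Test) (p : Prog)

/-- A best-response subroutine for `n` objects in dimension `d`: its answer on each vector and the
time it takes to compute it. -/
structure Subroutine (n d : ℕ) where
  answer : MaxVec n d → MinVec n d
  time : MaxVec n d → ℕ

/-- The vector of the max-player stored from address `p` on, as `n` consecutive blocks of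
length `d + 1`; block `i` is `(y i, s i)`. -/
noncomputable def readMax (n d : ℕ) (m : ℕ → ℝ) (p : ℕ) : MaxVec n d := fun i =>
  (WithLp.toLp 2 fun j : Fin d => m (p + i * (d + 1) + j), m (p + i * (d + 1) + d))

/-- The cells that store the vector `(x, v 1, ..., v n)`, as `n + 1` consecutive blocks of
length `d`. -/
noncomputable def cells {n d : ℕ} (a : MinVec n d) (k : Fin ((n + 1) * d)) : ℝ :=
  (Fin.cons a.1 a.2 : Fin (n + 1) → Pt d) k.divNat k.modNat

/-- The memory `m` after `a` has been written from address `q` on. -/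
noncomputable def writeMin {n d : ℕ} (m : ℕ → ℝ) (q : ℕ) (a : MinVec n d) : ℕ → ℝ := fun k =>
  if h : q ≤ k ∧ k - q < (n + 1) * d then cells a ⟨k - q, h.2⟩ else m k

/-- `Exec O P σ σ' L t`: started in `σ`, the program `P` halts in `σ'` after time `t`, having
called the subroutine `O` exactly on the members of the list `L`, in this order. -/
inductive Exec {n d : ℕ} (O : Subroutine n d) :
    Prog → State → State → List (MaxVec n d) → ℕ → Prop
  | skip (σ : State) : Exec O .skip σ σ [] 0
  | instr (i : Instr) (σ : State) : Exec O (.instr i) σ (i.apply σ) [] 1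
  | call (a b : ℕ) (σ : State) :
      Exec O (.call a b) σ
        ⟨σ.nat, writeMin σ.real (σ.nat b) (O.answer (readMax n d σ.real (σ.nat a)))⟩
        [readMax n d σ.real (σ.nat a)]
        (1 + O.time (readMax n d σ.real (σ.nat a)))
  | seq {p q : Prog} {σ σ₁ σ₂ : State} {L₁ L₂ : List (MaxVec n d)} {t₁ t₂ : ℕ} :
      Exec O p σ σ₁ L₁ t₁ → Exec O q σ₁ σ₂ L₂ t₂ → Exec O (.seq p q) σ σ₂ (L₁ ++ L₂) (t₁ + t₂)
  | branchTrue {c : Test} {p q : Prog} {σ σ₁ : State} {L : List (MaxVec n d)} {t : ℕ} :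
      c.Holds σ → Exec O p σ σ₁ L t → Exec O (.branch c p q) σ σ₁ L (1 + t)
  | branchFalse {c : Test} {p q : Prog} {σ σ₁ : State} {L : List (MaxVec n d)} {t : ℕ} :
      ¬ c.Holds σ → Exec O q σ σ₁ L t → Exec O (.branch c p q) σ σ₁ L (1 + t)
  | loopDone {c : Test} {p : Prog} {σ : State} :
      ¬ c.Holds σ → Exec O (.loop c p) σ σ [] 1
  | loopStep {c : Test} {p : Prog} {σ σ₁ σ₂ : State} {L₁ L₂ : List (MaxVec n d)} {t₁ t₂ : ℕ} :
      c.Holds σ → Exec O p σ σ₁ L₁ t₁ → Exec O (.loop c p) σ₁ σ₂ L₂ t₂ →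
      Exec O (.loop c p) σ σ₂ (L₁ ++ L₂) (1 + t₁ + t₂)

/-- The machine is deterministic, so the final state, the calls and the running time of a program
are determined by its initial state and the subroutine. -/
theorem Exec.det {n d : ℕ} {O : Subroutine n d} {P : Prog} {σ σ₁ : State}
    {L₁ : List (MaxVec n d)} {t₁ : ℕ} (h₁ : Exec O P σ σ₁ L₁ t₁) :
    ∀ {σ₂ : State} {L₂ : List (MaxVec n d)} {t₂ : ℕ}, Exec O P σ σ₂ L₂ t₂ →
      σ₁ = σ₂ ∧ L₁ = L₂ ∧ t₁ = t₂ := by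
  induction h₁ with
  | skip σ => intro _ _ _ h; cases h; exact ⟨rfl, rfl, rfl⟩
  | instr i σ => intro _ _ _ h; cases h; exact ⟨rfl, rfl, rfl⟩
  | call a b σ => intro _ _ _ h; cases h; exact ⟨rfl, rfl, rfl⟩
  | seq _ _ ih₁ ih₂ =>
    intro _ _ _ h
    cases h with
    | seq g₁ g₂ =>
      obtain ⟨rfl, rfl, rfl⟩ := ih₁ g₁
      obtain ⟨rfl, rfl, rfl⟩ := ih₂ g₂
      exact ⟨rfl, rfl, rfl⟩
  | branchTrue hc _ ih =>
    intro _ _ _ h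
    cases h with
    | branchTrue _ g => obtain ⟨rfl, rfl, rfl⟩ := ih g; exact ⟨rfl, rfl, rfl⟩
    | branchFalse hn _ => exact absurd hc hn
  | branchFalse hc _ ih =>
    intro _ _ _ h
    cases h with
    | branchTrue hn _ => exact absurd hn hc
    | branchFalse _ g => obtain ⟨rfl, rfl, rfl⟩ := ih g; exact ⟨rfl, rfl, rfl⟩
  | loopDone hc =>
    intro _ _ _ h
    cases h with
    | loopDone _ => exact ⟨rfl, rfl, rfl⟩
    | loopStep hn _ _ => exact absurd hn hc
  | loopStep hc _ _ ih₁ ih₂ =>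
    intro _ _ _ h
    cases h with
    | loopDone hn => exact absurd hc hn
    | loopStep _ g₁ g₂ =>
      obtain ⟨rfl, rfl, rfl⟩ := ih₁ g₁
      obtain ⟨rfl, rfl, rfl⟩ := ih₂ g₂
      exact ⟨rfl, rfl, rfl⟩

/-- The initial memory: the number of objects and the dimension in the first two natural-number
cells, the accuracy in the first real cell, and zero elsewhere. -/
noncomputable def initial (n d : ℕ) (ε : ℝ) : State where
  nat := fun k => if k = 0 then n else if k = 1 then d else 0
  real := fun k => if k = 0 then ε else 0

/-- The radius that the machine outputs: the contents of the first real cell. -/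
def State.outRadius (σ : State) : ℝ := σ.real 0

/-- The centre that the machine outputs: the contents of the `d` real cells from the address held
in the first natural-number cell on. -/
noncomputable def State.outCentre (d : ℕ) (σ : State) : Pt d :=
  WithLp.toLp 2 fun j : Fin d => σ.real (σ.nat 0 + j)

end SIB

namespace SIB

/-! ## Geometry of the smallest intersecting ball -/

/-! The problem is treated as a bilinear game. Every best response has payoff at most `r* =
optRadius Ω`: project the centre of an intersecting ball onto the hull of the points where it meets
the objects (`payoff_le_optRadius`). Let `A i` be the sum of the differences `x - v i` over `T`
answers and `P ≤ T r*` the total payoff. By convexity the averaged answers give a ball of radius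
`max ‖A i‖ / T` meeting every object, so once `max ‖A i‖ ≤ (1 + ε) P` this ball is good enough
(`Valid.isApproxSolution`).

The max-player needs small regret. It plays `y i = p i • A i / N_h (A i)`, where `N_h a = √(‖a‖² +
h²)` and `p` are multiplicative weights driven by the increments of `N_h (A i) / h`. An answer moves
`N_h` by at most its linear part plus a term of order `D² / h` (`smoothNorm_sub_le`), and the
`p`-average of the linear parts is the payoff. The weights are multiplied by `1 + v + v²` instead of
`exp v`, because the machine has no exponential; `exp_sub_sq_le` shows that this suffices. The
outcome is `max ‖A i‖ ≤ P + h (1 + log n) + 2 T D² / h` (`WeightBound.norm_gap_le`).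

A good `h` depends on `D` and `r*`, which the program cannot see. It therefore works in epochs: with
`lam ≥ 1 + log n`, an epoch is abandoned when `max ‖A i‖ > 3 lam h + P`, and `h` is then more than
doubled. Failure forces `h = O(D² / (ε r*))` (`Valid.h_le_of_not_good`), while in an epoch that
neither stops nor fails `T = O(lam h / (ε r*))`. As `h` grows geometrically, the rounds of all
epochs sum to `O(lam R² / ε²)` (`Valid.total_le_bound`). Each round is one call and `O(nd)` further
steps (`iterProg_exec`), and `lam = 1 + ⌈log₂ n⌉ = O(log n)`. -/

/-- The differences `x - v i` of a vector of the min-player. -/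
def gap {n d : ℕ} (p : MinVec n d) : Fin n → Pt d := fun i => p.1 - p.2 i

theorem gap_zero {n d : ℕ} : gap (0 : MinVec n d) = 0 := by
  funext i; simp [gap]

theorem gap_add {n d : ℕ} (p q : MinVec n d) : gap (p + q) = gap p + gap q := by
  funext i; simp only [gap, Prod.fst_add, Prod.snd_add, Pi.add_apply]; abel

theorem gap_smul {n d : ℕ} (c : ℝ) (p : MinVec n d) : gap (c • p) = c • gap p := by
  funext i; simp [gap, smul_sub]

theorem payoff_eq {n d : ℕ} (p : MinVec n d) (y : MaxVec n d) :
    payoff p y = ∑ i, inner ℝ (gap p i) (y i).1 := by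
  simp [payoff, gap]

theorem optRadius_le {n d : ℕ} {Ω : Fin n → Set (Pt d)} {x : Pt d} {r : ℝ} (hr : 0 ≤ r)
    (h : ∀ i, (Metric.closedBall x r ∩ Ω i).Nonempty) : optRadius Ω ≤ r :=
  csInf_le ⟨0, fun _ hr => hr.1⟩ ⟨hr, x, h⟩

/-- The norm on a finite product is the maximum, so `‖gap p‖` is the radius of a ball around `p.1`
that reaches every `p.2 i`. -/
theorem optRadius_le_norm_gap {n d : ℕ} {Ω : Fin n → Set (Pt d)} {p : MinVec n d}
    (h : ∀ i, p.2 i ∈ Ω i) : optRadius Ω ≤ ‖gap p‖ :=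
  optRadius_le (x := p.1) (norm_nonneg _) fun i => ⟨p.2 i, by
    rw [Metric.mem_closedBall, dist_comm, dist_eq_norm]; exact norm_le_pi_norm (gap p) i, h i⟩

theorem norm_gap_le_diam {n d : ℕ} {Ω : Fin n → Set (Pt d)} (hc : ∀ i, IsCompact (Ω i))
    {p : MinVec n d} (hp : p ∈ minSet Ω) : ‖gap p‖ ≤ Metric.diam (⋃ i, Ω i) := by
  refine (pi_norm_le_iff_of_nonneg Metric.diam_nonneg).2 fun i => ?_
  rw [← convexHull_diam, gap, ← dist_eq_norm]
  refine Metric.dist_le_diam_of_mem ?_ hp.1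
    (subset_convexHull ℝ _ (Set.mem_iUnion.2 ⟨i, hp.2 i⟩))
  exact (isBounded_convexHull.2 (isCompact_iUnion hc).isBounded)

/-- Projecting onto a complete convex set does not increase distances to points of that set. -/
theorem exists_mem_forall_norm_sub_le {d : ℕ} {K : Set (Pt d)} (hne : K.Nonempty)
    (hK : IsComplete K) (hconv : Convex ℝ K) (x : Pt d) :
    ∃ q ∈ K, ∀ v ∈ K, ‖q - v‖ ≤ ‖x - v‖ := by
  obtain ⟨q, hq, hmin⟩ := exists_norm_eq_iInf_of_complete_convex hne hK hconv x
  refine ⟨q, hq, fun v hv => ?_⟩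
  have h := (norm_eq_iInf_iff_real_inner_le_zero hconv hq).1 hmin v hv
  have e : x - v = (x - q) - (v - q) := by abel
  have h2 : ‖x - v‖ ^ 2 = ‖x - q‖ ^ 2 - 2 * inner ℝ (x - q) (v - q) + ‖v - q‖ ^ 2 := by
    rw [e, norm_sub_sq_real]
  rw [norm_sub_rev q v]
  exact (abs_le_of_sq_le_sq' (by nlinarith [sq_nonneg ‖x - q‖]) (norm_nonneg _)).2

theorem payoff_le_of_forall_norm_le {n d : ℕ} {y : MaxVec n d} (hy : y ∈ maxSet n d)
    {p : MinVec n d} {r : ℝ} (h : ∀ i, ‖gap p i‖ ≤ r) : payoff p y ≤ r := by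
  rw [payoff_eq, ← mul_one r, ← hy.2, Finset.mul_sum]
  refine Finset.sum_le_sum fun i _ => (real_inner_le_norm _ _).trans ?_
  exact mul_le_mul (h i) (hy.1 i) (norm_nonneg _) ((norm_nonneg _).trans (h i))

/-- The centre of an intersecting ball may lie outside the strategy set. Its projection onto the
hull of the chosen contact points lies inside and is no farther from any of them, so it is a
legitimate competitor to the best response. -/
theorem payoff_le_optRadius {n d : ℕ} {Ω : Fin n → Set (Pt d)} (hne : ∀ i, (Ω i).Nonempty) (hn : 0 < n)
    {y : MaxVec n d}
    (hy : y ∈ maxSet n d) {p : MinVec n d} (hp : IsBestResponse Ω y p) :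
    payoff p y ≤ optRadius Ω := by
  refine le_csInf ?_ ?_
  · choose v hv using hne
    refine ⟨‖gap ((0 : Pt d), v)‖, norm_nonneg _, 0, fun i => ⟨v i, ?_, hv i⟩⟩
    rw [Metric.mem_closedBall, dist_comm, dist_eq_norm]
    exact norm_le_pi_norm (gap ((0 : Pt d), v)) i
  · rintro r ⟨hr, x, hx⟩
    choose v hv using hx
    have hsub : Set.range v ⊆ ⋃ i, Ω i := by
      rintro _ ⟨i, rfl⟩; exact Set.mem_iUnion.2 ⟨i, (hv i).2⟩
    obtain ⟨q, hq, hqv⟩ := exists_mem_forall_norm_sub_le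
      (K := convexHull ℝ (Set.range v)) ⟨_, subset_convexHull ℝ _ (Set.mem_range_self ⟨0, hn⟩)⟩
      ((Set.finite_range v).isCompact_convexHull ℝ).isComplete (convex_convexHull ℝ _) x
    refine (hp.2 (q, v) ⟨convexHull_mono hsub hq, fun i => (hv i).2⟩).trans
      (payoff_le_of_forall_norm_le hy fun i =>
        (hqv _ (subset_convexHull ℝ _ (Set.mem_range_self i))).trans ?_)
    rw [← dist_eq_norm, dist_comm]
    exact (hv i).1

/-- A ball of radius zero meets a single object. This keeps `Real.log n` away from zero in the
running time. -/
theorem two_le_of_optRadius_pos {n d : ℕ} {Ω : Fin n → Set (Pt d)} (hne : ∀ i, (Ω i).Nonempty)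
    (h : 0 < optRadius Ω) : 2 ≤ n := by
  by_contra hn
  refine absurd h (not_lt.2 ?_)
  rcases (show n = 0 ∨ n = 1 by omega) with rfl | rfl
  · exact optRadius_le (x := 0) le_rfl fun i => i.elim0
  · obtain ⟨x, hx⟩ := hne 0
    refine optRadius_le (x := x) le_rfl fun i => ⟨x, by simp, ?_⟩
    rwa [Subsingleton.elim i 0]

/-- A space of dimension zero is a point. Positivity of `d` lets `n * d` absorb the costs of order
`n`. -/
theorem dim_pos_of_optRadius_pos {n d : ℕ} {Ω : Fin n → Set (Pt d)}
    (hne : ∀ i, (Ω i).Nonempty) (h : 0 < optRadius Ω) : 0 < d := by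
  by_contra hd
  obtain rfl : d = 0 := by omega
  refine absurd h (not_lt.2 (optRadius_le (x := 0) le_rfl fun i => ?_))
  obtain ⟨x, hx⟩ := hne i
  exact ⟨x, by simp [Subsingleton.elim x 0], hx⟩

/-! ## The smoothed norm -/

/-- The smoothed Euclidean norm with parameter `h`. -/
noncomputable def smoothNorm {d : ℕ} (h : ℝ) (a : Pt d) : ℝ := √(‖a‖ ^ 2 + h * h)

section smoothNorm
variable {d : ℕ} {h : ℝ} (a z : Pt d)

theorem sq_smoothNorm : smoothNorm h a ^ 2 = ‖a‖ ^ 2 + h * h :=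
  Real.sq_sqrt (by nlinarith [mul_self_nonneg h, sq_nonneg ‖a‖])

theorem smoothNorm_nonneg : 0 ≤ smoothNorm h a := Real.sqrt_nonneg _

theorem norm_le_smoothNorm : ‖a‖ ≤ smoothNorm h a :=
  Real.le_sqrt_of_sq_le (by nlinarith [mul_self_nonneg h])

theorem le_smoothNorm : h ≤ smoothNorm h a :=
  Real.le_sqrt_of_sq_le (by nlinarith [sq_nonneg ‖a‖])

theorem smoothNorm_zero (hh : 0 ≤ h) : smoothNorm h (0 : Pt d) = h := by
  simp [smoothNorm, Real.sqrt_mul_self hh]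

theorem sq_smoothNorm_add :
    smoothNorm h (a + z) ^ 2 = smoothNorm h a ^ 2 + 2 * inner ℝ a z + ‖z‖ ^ 2 := by
  rw [sq_smoothNorm, sq_smoothNorm, norm_add_sq_real]; ring

theorem smoothNorm_add_le : smoothNorm h (a + z) ≤ smoothNorm h a + ‖z‖ := by
  refine (abs_le_of_sq_le_sq' ?_ (add_nonneg (smoothNorm_nonneg a) (norm_nonneg z))).2
  rw [sq_smoothNorm_add]
  have h1 := real_inner_le_norm a z
  have h2 := mul_le_mul_of_nonneg_right (norm_le_smoothNorm (h := h) a) (norm_nonneg z)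
  nlinarith

theorem abs_smoothNorm_sub_le : |smoothNorm h (a + z) - smoothNorm h a| ≤ ‖z‖ := by
  rw [abs_le]
  have h1 := smoothNorm_add_le (h := h) (a + z) (-z)
  rw [norm_neg, add_neg_cancel_right] at h1
  have h2 := smoothNorm_add_le (h := h) a z
  constructor <;> linarith

/-- The tangent of the square root at `N(a)²` gives `N(a+z) - N(a) ≤ (N(a+z)² - N(a)²) / (2 N(a))`,
and `N(a) ≥ h` bounds the quadratic term. The smoothing serves to make this term finite near `a =
0`. -/
theorem smoothNorm_sub_le (hh : 0 < h) :
    smoothNorm h (a + z) - smoothNorm h a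
      ≤ inner ℝ a z / smoothNorm h a + ‖z‖ ^ 2 / (2 * h) := by
  have hN : h ≤ smoothNorm h a := le_smoothNorm a
  have hN0 : 0 < smoothNorm h a := hh.trans_le hN
  have h1 : ‖z‖ ^ 2 / (2 * smoothNorm h a) ≤ ‖z‖ ^ 2 / (2 * h) := by gcongr
  have h2 : smoothNorm h (a + z) - smoothNorm h a
      ≤ inner ℝ a z / smoothNorm h a + ‖z‖ ^ 2 / (2 * smoothNorm h a) := by
    have e : inner ℝ a z / smoothNorm h a + ‖z‖ ^ 2 / (2 * smoothNorm h a)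
        = (smoothNorm h (a + z) ^ 2 - smoothNorm h a ^ 2) / (2 * smoothNorm h a) := by
      rw [sq_smoothNorm_add]; field_simp; ring
    rw [e, le_div_iff₀ (by positivity)]
    nlinarith [sq_nonneg (smoothNorm h (a + z) - smoothNorm h a)]
  linarith

end smoothNorm

/-- Valid for every real `x`, which matters because increments may be large while `h` is still too
small. For `x ≥ 0` use `log (1 + x) ≥ 2x / (x + 2)`; for `x ≤ 0` use `exp (-x) ≥ 1 - x + x²/2` and
multiply the two quadratics. -/
theorem exp_sub_sq_le (x : ℝ) : Real.exp (x - x ^ 2 / 2) ≤ x ^ 2 + x + 1 := by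
  rcases le_total 0 x with hx | hx
  · have h1 : x - x ^ 2 / 2 ≤ Real.log (1 + x) := by
      refine le_trans ?_ (Real.le_log_one_add_of_nonneg hx)
      rw [le_div_iff₀ (by positivity)]
      nlinarith [pow_nonneg hx 3]
    have h2 := (Real.le_log_iff_exp_le (by positivity)).1 h1
    nlinarith [sq_nonneg x]
  · have h1 := Real.quadratic_le_exp_of_nonneg (neg_nonneg.2 hx)
    have h2 : Real.exp (x - x ^ 2 / 2) ≤ Real.exp x :=
      Real.exp_le_exp.2 (by nlinarith [sq_nonneg x])
    have h3 : Real.exp x * Real.exp (-x) = 1 := by rw [← Real.exp_add]; simp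
    have h4 : 0 < Real.exp x := Real.exp_pos x
    have h5 : Real.exp x * (1 + -x + (-x) ^ 2 / 2) ≤ 1 := by
      exact (mul_le_mul_of_nonneg_left h1 h4.le).trans h3.le
    have h6 : 0 < 1 + -x + (-x) ^ 2 / 2 := by nlinarith [sq_nonneg x]
    have h7 : 1 ≤ (x ^ 2 + x + 1) * (1 + -x + (-x) ^ 2 / 2) := by
      nlinarith [sq_nonneg x, mul_nonneg (neg_nonneg.2 hx) (sq_nonneg x), sq_nonneg (x ^ 2)]
    exact h2.trans (le_of_mul_le_mul_right (h5.trans h7) h6)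

/-! ## The repeated game -/

/-- The state of the repeated game within an epoch: the smoothing parameter `h`, the number `T` of
rounds, the total payoff `P`, the sum `acc` of the min-player's answers and the weights `p` of the
objects. -/
structure GameState (n d : ℕ) where
  h : ℝ
  T : ℝ
  P : ℝ
  acc : MinVec n d
  p : Fin n → ℝ

namespace GameState
variable {n d : ℕ}

/-- The vector that the max-player plays. -/
noncomputable def query (s : GameState n d) : MaxVec n d := fun i =>
  ((s.p i / smoothNorm s.h (gap s.acc i)) • gap s.acc i, s.p i)

/-- The relative increments of the smoothed norms caused by the answer `a`. -/
noncomputable def incr (s : GameState n d) (a : MinVec n d) (i : Fin n) : ℝ :=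
  (smoothNorm s.h (gap s.acc i + gap a i) - smoothNorm s.h (gap s.acc i)) / s.h

/-- The updated weights before normalization. -/
noncomputable def raw (s : GameState n d) (a : MinVec n d) (i : Fin n) : ℝ :=
  s.p i * (s.incr a i ^ 2 + s.incr a i + 1)

/-- The total payoff after the answer `a`. -/
noncomputable def newPayoff (s : GameState n d) (a : MinVec n d) : ℝ :=
  s.P + payoff a s.query

/-- The maximal norm of the summed differences after the answer `a`. -/
noncomputable def newNorm (s : GameState n d) (a : MinVec n d) : ℝ := ‖gap (s.acc + a)‖

/-- The next state within the epoch. -/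
noncomputable def continued (s : GameState n d) (a : MinVec n d) : GameState n d where
  h := s.h
  T := s.T + 1
  P := s.newPayoff a
  acc := s.acc + a
  p := fun i => s.raw a i / ∑ k, s.raw a k

/-- The first state of an epoch. -/
noncomputable def start (n d : ℕ) (h : ℝ) : GameState n d where
  h := h
  T := 0
  P := 0
  acc := 0
  p := fun _ => 1 / n

/-- The state after the epoch has been abandoned. -/
noncomputable def restarted (s : GameState n d) (a : MinVec n d) : GameState n d :=
  start n d (s.h + s.h + s.newNorm a / (s.T + 1))

/-! ### Regret of the max-player -/

theorem query_mem_maxSet {s : GameState n d} (hp : ∀ i, 0 < s.p i) (hs : ∑ i, s.p i = 1) :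
    s.query ∈ maxSet n d := by
  refine ⟨fun i => ?_, hs⟩
  have h1 := norm_le_smoothNorm (h := s.h) (gap s.acc i)
  have h0 := smoothNorm_nonneg (h := s.h) (gap s.acc i)
  simp only [query, norm_smul, norm_div, Real.norm_eq_abs, abs_of_pos (hp i), abs_of_nonneg h0]
  rw [div_mul_eq_mul_div]
  -- The smoothed norm may vanish when `h = 0`; this form of the inequality also covers a zero
  -- denominator.
  exact div_le_of_le_mul₀ h0 (hp i).le (mul_le_mul_of_nonneg_left h1 (hp i).le)

theorem raw_pos {s : GameState n d} (hp : ∀ i, 0 < s.p i) (a : MinVec n d) (i : Fin n) :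
    0 < s.raw a i :=
  mul_pos (hp i) (by nlinarith [sq_nonneg (s.incr a i + 1), sq_nonneg (s.incr a i)])

theorem abs_incr_le {s : GameState n d} (hh : 0 < s.h) {a : MinVec n d} {D : ℝ}
    (ha : ‖gap a‖ ≤ D) (i : Fin n) : |s.incr a i| ≤ D / s.h := by
  rw [incr, abs_div, abs_of_pos hh]
  gcongr
  exact (abs_smoothNorm_sub_le _ _).trans ((norm_le_pi_norm (gap a) i).trans ha)

theorem incr_le {s : GameState n d} (hh : 0 < s.h) {a : MinVec n d} {D : ℝ}
    (ha : ‖gap a‖ ≤ D) (i : Fin n) :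
    s.incr a i ≤ inner ℝ (gap s.acc i) (gap a i) / smoothNorm s.h (gap s.acc i) / s.h
      + D ^ 2 / s.h ^ 2 / 2 := by
  have h1 := smoothNorm_sub_le (gap s.acc i) (gap a i) hh
  have h2 : ‖gap a i‖ ^ 2 ≤ D ^ 2 :=
    pow_le_pow_left₀ (norm_nonneg _) ((norm_le_pi_norm (gap a) i).trans ha) 2
  have h3 : ‖gap a i‖ ^ 2 / (2 * s.h) ≤ D ^ 2 / (2 * s.h) := by gcongr
  rw [incr]
  calc _ ≤ (inner ℝ (gap s.acc i) (gap a i) / smoothNorm s.h (gap s.acc i)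
        + D ^ 2 / (2 * s.h)) / s.h := by gcongr; linarith
    _ = _ := by field_simp

theorem payoff_query (s : GameState n d) (a : MinVec n d) :
    payoff a s.query
      = ∑ i, s.p i * (inner ℝ (gap s.acc i) (gap a i) / smoothNorm s.h (gap s.acc i)) := by
  rw [payoff_eq]
  refine Finset.sum_congr rfl fun i _ => ?_
  rw [query, real_inner_smul_right, real_inner_comm]; ring

/-- The linear parts of the increments average to the payoff. The factor `3 / 2` is `1 / 2` from the
curvature of the smoothed norm plus `1` from the squared increment. -/
theorem sum_raw_le {s : GameState n d} (hh : 0 < s.h) (hp : ∀ i, 0 < s.p i)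
    (hs : ∑ i, s.p i = 1) {a : MinVec n d} {D : ℝ} (ha : ‖gap a‖ ≤ D) :
    ∑ i, s.raw a i ≤ 1 + payoff a s.query / s.h + 3 / 2 * (D ^ 2 / s.h ^ 2) := by
  have key : ∀ i, s.raw a i ≤ s.p i
      + s.p i * (inner ℝ (gap s.acc i) (gap a i) / smoothNorm s.h (gap s.acc i)) / s.h
      + s.p i * (3 / 2 * (D ^ 2 / s.h ^ 2)) := by
    intro i
    have h1 := abs_incr_le hh ha i
    have h2 := incr_le hh ha i
    have h3 : s.incr a i ^ 2 ≤ D ^ 2 / s.h ^ 2 := by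
      rw [← div_pow, ← sq_abs]; exact pow_le_pow_left₀ (abs_nonneg _) h1 2
    calc s.raw a i ≤ s.p i * (D ^ 2 / s.h ^ 2
          + (inner ℝ (gap s.acc i) (gap a i) / smoothNorm s.h (gap s.acc i) / s.h
            + D ^ 2 / s.h ^ 2 / 2) + 1) :=
          mul_le_mul_of_nonneg_left (by linarith) (hp i).le
      _ = _ := by ring
  refine (Finset.sum_le_sum fun i _ => key i).trans (le_of_eq ?_)
  rw [Finset.sum_add_distrib, Finset.sum_add_distrib, ← Finset.sum_mul, ← Finset.sum_div,
    ← payoff_query, hs, one_mul]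

/-- The lower bound on the weights that encodes the regret bound. -/
def WeightBound (D : ℝ) (s : GameState n d) : Prop :=
  ∀ i, 1 / (n : ℝ) * Real.exp ((smoothNorm s.h (gap s.acc i) - s.h - s.P) / s.h
    - 2 * s.T * (D ^ 2 / s.h ^ 2)) ≤ s.p i

/-- The unnormalized weight grows by at least `exp (v - D² / (2h²))`, while the normalizing sum is
at most `exp (payoff / h + 3D² / (2h²))`. Together the errors make `2D² / h²` per round. -/
theorem WeightBound.continued {s : GameState n d} {D : ℝ} (hw : s.WeightBound D) (hh : 0 < s.h)
    (hp : ∀ i, 0 < s.p i) (hs : ∑ i, s.p i = 1) {a : MinVec n d} (ha : ‖gap a‖ ≤ D) :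
    (s.continued a).WeightBound D := by
  intro i
  have hZ := sum_raw_le hh hp hs ha
  have hZ0 : 0 < ∑ k, s.raw a k :=
    Finset.sum_pos (fun k _ => raw_pos hp a k) ⟨i, Finset.mem_univ i⟩
  have hZe : ∑ k, s.raw a k ≤ Real.exp (payoff a s.query / s.h + 3 / 2 * (D ^ 2 / s.h ^ 2)) :=
    hZ.trans (by
      have := Real.add_one_le_exp (payoff a s.query / s.h + 3 / 2 * (D ^ 2 / s.h ^ 2)); linarith)
  have h3 : s.incr a i ^ 2 ≤ D ^ 2 / s.h ^ 2 := by
    rw [← div_pow, ← sq_abs]; exact pow_le_pow_left₀ (abs_nonneg _) (abs_incr_le hh ha i) 2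
  have h4 : Real.exp (s.incr a i - D ^ 2 / s.h ^ 2 / 2) ≤ s.incr a i ^ 2 + s.incr a i + 1 :=
    (Real.exp_le_exp.2 (by linarith)).trans (exp_sub_sq_le _)
  change _ ≤ s.raw a i / _
  rw [le_div_iff₀ hZ0]
  calc _ ≤ 1 / (n : ℝ) * Real.exp ((smoothNorm s.h (gap (s.acc + a) i) - s.h - s.newPayoff a) / s.h
        - 2 * (s.T + 1) * (D ^ 2 / s.h ^ 2))
        * Real.exp (payoff a s.query / s.h + 3 / 2 * (D ^ 2 / s.h ^ 2)) :=
        mul_le_mul_of_nonneg_left hZe (by positivity)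
    _ = 1 / (n : ℝ) * Real.exp ((smoothNorm s.h (gap s.acc i) - s.h - s.P) / s.h
          - 2 * s.T * (D ^ 2 / s.h ^ 2)) * Real.exp (s.incr a i - D ^ 2 / s.h ^ 2 / 2) := by
        rw [mul_assoc (1 / (n : ℝ)), mul_assoc (1 / (n : ℝ)), ← Real.exp_add, ← Real.exp_add, newPayoff, incr, gap_add,
          Pi.add_apply]
        congr 2; ring
    _ ≤ s.p i * (s.incr a i ^ 2 + s.incr a i + 1) :=
        mul_le_mul (hw i) h4 (Real.exp_pos _).le (hp i).le

/-- A weight is at most one; taking logarithms of its lower bound gives the regret bound. -/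
theorem WeightBound.norm_gap_le {s : GameState n d} {D : ℝ} (hw : s.WeightBound D)
    (hh : 0 < s.h) (hp : ∀ i, 0 < s.p i) (hs : ∑ i, s.p i = 1) (i : Fin n) :
    ‖gap s.acc i‖ ≤ s.P + s.h * (1 + Real.log n) + 2 * s.T * (D ^ 2 / s.h) := by
  have hn : (0 : ℝ) < n := by exact_mod_cast i.pos
  have h1 : s.p i ≤ 1 := hs ▸ Finset.single_le_sum (fun k _ => (hp k).le) (Finset.mem_univ i)
  have h2 := (hw i).trans h1
  rw [one_div, inv_mul_le_iff₀ hn, mul_one, ← Real.le_log_iff_exp_le hn] at h2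
  have h3 := norm_le_smoothNorm (h := s.h) (gap s.acc i)
  have h4 : (smoothNorm s.h (gap s.acc i) - s.h - s.P) / s.h
      ≤ Real.log n + 2 * s.T * (D ^ 2 / s.h ^ 2) := by linarith
  rw [div_le_iff₀ hh] at h4
  have h5 : (Real.log n + 2 * s.T * (D ^ 2 / s.h ^ 2)) * s.h
      = Real.log n * s.h + 2 * s.T * (D ^ 2 / s.h) := by field_simp
  linarith

/-- The invariant of the repeated game: `L` lists the queries of the current epoch and `N` counts
all rounds. -/
structure Valid (Ω : Fin n → Set (Pt d)) (ans : MaxVec n d → MinVec n d) (lam ε r D : ℝ)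
    (L : List (MaxVec n d)) (N : ℕ) (s : GameState n d) : Prop where
  h_nonneg : 0 ≤ s.h
  h_le : s.h ≤ 25 * (D ^ 2 / (ε * r))
  T_eq : s.T = L.length
  acc_eq : s.acc = (L.map ans).sum
  p_pos : ∀ i, 0 < s.p i
  p_sum : ∑ i, s.p i = 1
  P_le : s.P ≤ s.T * r
  gap_le : ‖gap s.acc‖ ≤ s.T * D
  acc_mem : ∀ i, ∃ w ∈ Ω i, s.acc.2 i = s.T • w
  rounds_le : ε * s.T * r ≤ 6 * lam * s.h
  weight : 0 < s.h → s.WeightBound D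
  total_le : (N : ℝ) ≤ s.T + 6 * lam * s.h / (ε * r)

theorem weightBound_start {h D : ℝ} (hh : 0 < h) : (start n d h).WeightBound D := by
  intro i
  simp only [start, gap_zero, Pi.zero_apply, smoothNorm_zero hh.le]
  simp

theorem sum_start_p (hn : 0 < n) (h : ℝ) : ∑ i, (start n d h).p i = 1 := by
  have : (n : ℝ) ≠ 0 := by positivity
  simp [start, this]

/-! ### Epochs and the number of rounds -/

section steps
variable {Ω : Fin n → Set (Pt d)} {ans : MaxVec n d → MinVec n d} {lam ε D : ℝ}
  {L : List (MaxVec n d)} {N : ℕ} {s : GameState n d}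

/-- The form `T • w` says that the average lies in the object and stays meaningful for `T = 0`. -/
theorem exists_mem_add (hconv : ∀ i, Convex ℝ (Ω i)) {acc a : MinVec n d} {T : ℝ} (hT : 0 ≤ T)
    (hacc : ∀ i, ∃ w ∈ Ω i, acc.2 i = T • w) (ha : ∀ i, a.2 i ∈ Ω i) (i : Fin n) :
    ∃ w ∈ Ω i, (acc + a).2 i = (T + 1) • w := by
  obtain ⟨w, hw, e⟩ := hacc i
  have hT1 : 0 < T + 1 := by positivity
  refine ⟨(T / (T + 1)) • w + (1 / (T + 1)) • a.2 i,
    hconv i hw (ha i) (by positivity) (by positivity) (by field_simp), ?_⟩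
  rw [smul_add, smul_smul, smul_smul, mul_div_cancel₀ _ hT1.ne', mul_div_cancel₀ _ hT1.ne',
    one_smul, ← e]
  rfl

theorem mul_optRadius_le_norm_gap {acc : MinVec n d} {T : ℝ} (hT : 0 < T)
    (hacc : ∀ i, ∃ w ∈ Ω i, acc.2 i = T • w) : T * optRadius Ω ≤ ‖gap acc‖ := by
  choose w hw e using hacc
  have h1 : acc = T • ((T⁻¹ • acc.1, w) : MinVec n d) := by
    refine Prod.ext ?_ (funext fun i => ?_)
    · simp [smul_smul, hT.ne']
    · simp [e]
  rw [h1, gap_smul, norm_smul, Real.norm_of_nonneg hT.le]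
  exact mul_le_mul_of_nonneg_left (optRadius_le_norm_gap (p := (T⁻¹ • acc.1, w)) hw) hT.le

theorem Valid.start (hne : ∀ i, (Ω i).Nonempty) (hn : 0 < n) (hlam : 0 ≤ lam)
    {h : ℝ} (hh : 0 ≤ h) (hle : h ≤ 25 * (D ^ 2 / (ε * optRadius Ω)))
    (hN : (N : ℝ) ≤ 6 * lam * h / (ε * optRadius Ω)) :
    Valid Ω ans lam ε (optRadius Ω) D [] N (start n d h) where
  h_nonneg := hh
  h_le := hle
  T_eq := by simp [GameState.start]
  acc_eq := rfl
  p_pos := fun i => by have := i.pos; simp only [GameState.start]; positivity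
  p_sum := sum_start_p hn h
  P_le := by simp [GameState.start]
  gap_le := by simp [GameState.start, gap_zero]
  acc_mem := fun i => by
    obtain ⟨w, hw⟩ := hne i
    exact ⟨w, hw, by simp [GameState.start]⟩
  rounds_le := by simp only [GameState.start]; simp; positivity
  weight := weightBound_start
  total_le := by simpa [GameState.start] using hN

variable (hv : Valid Ω ans lam ε (optRadius Ω) D L N s)
include hv

theorem Valid.T_nonneg : 0 ≤ s.T := hv.T_eq ▸ Nat.cast_nonneg _

theorem Valid.query_mem : s.query ∈ maxSet n d := query_mem_maxSet hv.p_pos hv.p_sum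

theorem Valid.mul_le_newNorm (hconv : ∀ i, Convex ℝ (Ω i)) {a : MinVec n d}
    (ha : ∀ i, a.2 i ∈ Ω i) : (s.T + 1) * optRadius Ω ≤ s.newNorm a :=
  mul_optRadius_le_norm_gap (by have := hv.T_nonneg; positivity)
    (exists_mem_add hconv hv.T_nonneg hv.acc_mem ha)

theorem Valid.newNorm_le {a : MinVec n d} (ha : ‖gap a‖ ≤ D) :
    s.newNorm a ≤ (s.T + 1) * D := by
  rw [newNorm, gap_add]
  refine (norm_add_le _ _).trans ?_
  have := hv.gap_le
  linarith

theorem Valid.continued (hconv : ∀ i, Convex ℝ (Ω i)) (hn : 0 < n) (hε : 0 < ε) (hε1 : ε ≤ 1)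
    (hlam : 0 ≤ lam) (hans : (ans s.query).2 ∈ Set.univ.pi Ω)
    (hgap : ‖gap (ans s.query)‖ ≤ D) (hpay : payoff (ans s.query) s.query ≤ optRadius Ω)
    (hdone : (1 + ε) * s.newPayoff (ans s.query) < s.newNorm (ans s.query))
    (hgood : s.newNorm (ans s.query) ≤ 3 * (lam * s.h) + s.newPayoff (ans s.query)) :
    Valid Ω ans lam ε (optRadius Ω) D (L ++ [s.query]) (N + 1) (s.continued (ans s.query)) := by
  have ha : ∀ i, (ans s.query).2 i ∈ Ω i := fun i => hans i (Set.mem_univ i)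
  have hZ0 : 0 < ∑ k, s.raw (ans s.query) k :=
    Finset.sum_pos (fun k _ => raw_pos hv.p_pos _ k) ⟨⟨0, hn⟩, Finset.mem_univ _⟩
  refine ⟨hv.h_nonneg, hv.h_le, ?_, ?_, ?_, ?_, ?_, hv.newNorm_le hgap,
    exists_mem_add hconv hv.T_nonneg hv.acc_mem ha, ?_, ?_, ?_⟩
  · simp [GameState.continued, hv.T_eq]
  · simp [GameState.continued, hv.acc_eq]
  · exact fun i => div_pos (raw_pos hv.p_pos _ i) hZ0
  · simp only [GameState.continued]
    rw [← Finset.sum_div, div_self hZ0.ne']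
  · simp only [GameState.continued, newPayoff]
    linarith [hv.P_le]
  · have h1 := hv.mul_le_newNorm hconv ha
    simp only [GameState.continued]
    -- With `M` the new norm and `P` the new payoff, `M ≤ 3 lam h + P` and `(1 + ε) P < M` give `ε M
    -- ≤ 3 (1 + ε) lam h`.
    have h2 : ε * s.newNorm (ans s.query) ≤ 6 * (lam * s.h) := by
      have h0 := mul_nonneg hlam hv.h_nonneg
      nlinarith [mul_le_mul_of_nonneg_right hε1 h0, mul_le_mul_of_nonneg_left hgood hε.le]
    have h3 := mul_le_mul_of_nonneg_left h1 hε.le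
    linarith
  · exact fun hh => (hv.weight hh).continued hh hv.p_pos hv.p_sum hgap
  · simp only [GameState.continued]
    push_cast
    linarith [hv.total_le]

/-- Failure contradicts the regret bound unless `(T + 1) D²` exceeds `lam h²`. Since `T` is at most
`6 lam h / (ε r*)`, this cannot happen for large `h`. -/
theorem Valid.h_le_of_not_good (hlam : 1 + Real.log n ≤ lam) (hn : 0 < n)
    (hε : 0 < ε) (hε1 : ε ≤ 1) (hr : 0 < optRadius Ω) (hrD : optRadius Ω ≤ D)
    {a : MinVec n d} (hgap : ‖gap a‖ ≤ D)
    (hbad : 3 * (lam * s.h) + s.newPayoff a < s.newNorm a) :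
    s.h ≤ 12 * (D ^ 2 / (ε * optRadius Ω)) := by
  by_contra! hlt
  have hD : 0 < D := hr.trans_le hrD
  have hh : 0 < s.h := lt_of_le_of_lt (by positivity) hlt
  have hZ0 : 0 < ∑ k, s.raw a k :=
    Finset.sum_pos (fun k _ => raw_pos hv.p_pos _ k) ⟨⟨0, hn⟩, Finset.mem_univ _⟩
  have hw := (hv.weight hh).continued hh hv.p_pos hv.p_sum hgap
  have hl0 : 0 ≤ Real.log n := Real.log_natCast_nonneg n
  have hlam0 : 1 ≤ lam := by linarith
  have hT := hv.T_nonneg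
  have hreg : s.newNorm a
      ≤ s.newPayoff a + s.h * (1 + Real.log n) + 2 * (s.T + 1) * (D ^ 2 / s.h) := by
    have hb := hw.norm_gap_le hh (fun i => div_pos (raw_pos hv.p_pos _ i) hZ0)
      (by simp only [GameState.continued]; rw [← Finset.sum_div, div_self hZ0.ne'])
    exact (pi_norm_le_iff_of_nonneg ((norm_nonneg _).trans (hb ⟨0, hn⟩))).2 hb
  have h1 : s.h * (1 + Real.log n) ≤ lam * s.h := by nlinarith
  -- The term `h (1 + log n)` uses up one of the three copies of `lam h` in the failure test; the
  -- other two cancel the factor `2`.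
  have h2 : lam * s.h < (s.T + 1) * (D ^ 2 / s.h) := by nlinarith
  have h3 : lam * s.h * s.h < (s.T + 1) * D ^ 2 := by
    have := mul_lt_mul_of_pos_right h2 hh
    rwa [mul_assoc (s.T + 1), div_mul_cancel₀ _ hh.ne'] at this
  have hx : 0 < ε * optRadius Ω := by positivity
  rw [← mul_div_assoc, div_lt_iff₀ hx] at hlt
  have hxD : ε * optRadius Ω ≤ D := by nlinarith
  have h5 := hv.rounds_le
  have h6 : 12 * D < s.h := by
    by_contra! h7
    nlinarith [mul_le_mul h7 hxD hx.le (by positivity)]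
  have h8 : (s.T * (ε * optRadius Ω)) * (12 * D ^ 2)
      ≤ 6 * lam * s.h * (s.h * (ε * optRadius Ω)) := by
    have : s.T * (ε * optRadius Ω) ≤ 6 * lam * s.h := by linarith
    exact mul_le_mul this hlt.le (by positivity) (by positivity)
  -- The contradiction splits `(T + 1) D²` in two: `T D²` and the extra `D²` of the failing round
  -- each account for at most half of `lam h²`.
  have h9 : 2 * (s.T * D ^ 2) ≤ lam * s.h * s.h := by
    refine le_of_mul_le_mul_right (a := ε * optRadius Ω) ?_ hx
    nlinarith
  have h10 : 2 * D ^ 2 ≤ lam * s.h * s.h := by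
    have : (12 * D) * (12 * D) ≤ s.h * s.h := mul_le_mul h6.le h6.le (by positivity) hh.le
    nlinarith [mul_le_mul_of_nonneg_right hlam0 (mul_nonneg hh.le hh.le), sq_nonneg D]
  linarith

/-- The amount `M / (T + 1)` added to `2h` lies between `r*` and `D`. The upper bound turns `h ≤ 12
D² / (ε r*)` into `25 D² / (ε r*)`. By the lower bound, the allowance `6 lam h / (ε r*)` at the new
`h` pays for all earlier epochs, for the current one and for the failing round. -/
theorem Valid.restarted (hne : ∀ i, (Ω i).Nonempty) (hconv : ∀ i, Convex ℝ (Ω i))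
    (hlam : 1 + Real.log n ≤ lam) (hn : 0 < n)
    (hε : 0 < ε) (hε1 : ε ≤ 1) (hr : 0 < optRadius Ω) (hrD : optRadius Ω ≤ D)
    {a : MinVec n d} (ha : ∀ i, a.2 i ∈ Ω i) (hgap : ‖gap a‖ ≤ D)
    (hbad : 3 * (lam * s.h) + s.newPayoff a < s.newNorm a) :
    Valid Ω ans lam ε (optRadius Ω) D [] (N + 1) (s.restarted a) := by
  have hD : 0 < D := hr.trans_le hrD
  have hT := hv.T_nonneg
  have hT1 : 0 < s.T + 1 := by positivity
  have hx : 0 < ε * optRadius Ω := by positivity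
  have hl0 : 0 ≤ Real.log n := Real.log_natCast_nonneg n
  have hlam0 : 1 ≤ lam := by linarith
  have h1 : optRadius Ω ≤ s.newNorm a / (s.T + 1) := by
    rw [le_div_iff₀ hT1, mul_comm]; exact hv.mul_le_newNorm hconv ha
  have h2 : s.newNorm a / (s.T + 1) ≤ D := by
    rw [div_le_iff₀ hT1, mul_comm]; exact hv.newNorm_le hgap
  have h3 := hv.h_le_of_not_good hlam hn hε hε1 hr hrD hgap hbad
  have h4 : D ≤ D ^ 2 / (ε * optRadius Ω) := by
    have h0 : ε * optRadius Ω ≤ 1 * D := mul_le_mul hε1 hrD hr.le zero_le_one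
    rw [le_div_iff₀ hx]; nlinarith
  have hh := hv.h_nonneg
  refine Valid.start hne hn (by linarith) (by linarith) (by linarith) ?_
  have h5 := hv.total_le
  have h6 : s.T ≤ 6 * lam * s.h / (ε * optRadius Ω) := by
    rw [le_div_iff₀ hx]; have := hv.rounds_le; linarith
  have h7 : 1 ≤ 6 * lam * (s.newNorm a / (s.T + 1)) / (ε * optRadius Ω) := by
    rw [le_div_iff₀ hx]; nlinarith
  have h8 : 6 * lam * (s.h + s.h + s.newNorm a / (s.T + 1)) / (ε * optRadius Ω)
      = 6 * lam * s.h / (ε * optRadius Ω) + 6 * lam * s.h / (ε * optRadius Ω)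
        + 6 * lam * (s.newNorm a / (s.T + 1)) / (ε * optRadius Ω) := by ring
  push_cast
  linarith

/-- The current epoch and the allowance for all earlier ones are both at most `6 lam h / (ε r*)`,
hence `2 * 6 * 25 = 300`. -/
theorem Valid.total_le_bound (hlam : 0 ≤ lam) (hε : 0 < ε) (hr : 0 < optRadius Ω) :
    (N : ℝ) ≤ 300 * lam * ((D / optRadius Ω) ^ 2 / ε ^ 2) := by
  have hx : 0 < ε * optRadius Ω := by positivity
  have h1 := hv.total_le
  have h6 : s.T ≤ 6 * lam * s.h / (ε * optRadius Ω) := by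
    rw [le_div_iff₀ hx]; have := hv.rounds_le; linarith
  have h7 : 6 * lam * s.h / (ε * optRadius Ω)
      ≤ 6 * lam * (25 * (D ^ 2 / (ε * optRadius Ω))) / (ε * optRadius Ω) := by
    gcongr; exact hv.h_le
  have h8 : 6 * lam * (25 * (D ^ 2 / (ε * optRadius Ω))) / (ε * optRadius Ω)
      = 150 * lam * ((D / optRadius Ω) ^ 2 / ε ^ 2) := by field_simp; ring
  linarith

theorem Valid.isApproxSolution (hconv : ∀ i, Convex ℝ (Ω i)) {a : MinVec n d}
    (ha : ∀ i, a.2 i ∈ Ω i) (hε : 0 < ε) (hpay : payoff a s.query ≤ optRadius Ω)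
    (hdone : s.newNorm a ≤ (1 + ε) * s.newPayoff a) :
    IsApproxSolution Ω ε ((s.T + 1)⁻¹ • (s.acc + a).1) (s.newNorm a / (s.T + 1)) := by
  have hT := hv.T_nonneg
  have hT1 : 0 < s.T + 1 := by positivity
  refine ⟨fun i => ?_, ?_⟩
  · obtain ⟨w, hw, e⟩ := exists_mem_add hconv hT hv.acc_mem ha i
    refine ⟨w, ?_, hw⟩
    rw [Metric.mem_closedBall, dist_comm, dist_eq_norm, le_div_iff₀ hT1]
    have h1 : ‖gap (s.acc + a) i‖ ≤ s.newNorm a := norm_le_pi_norm (gap (s.acc + a)) i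
    refine le_trans (le_of_eq ?_) h1
    rw [gap, e, mul_comm, ← Real.norm_of_nonneg hT1.le, ← norm_smul, smul_sub, smul_smul,
      Real.norm_of_nonneg hT1.le, mul_inv_cancel₀ hT1.ne', one_smul]
  · rw [div_le_iff₀ hT1]
    have h1 : s.newPayoff a ≤ (s.T + 1) * optRadius Ω := by
      rw [newPayoff]; linarith [hv.P_le]
    nlinarith

end steps

end GameState

/-! ## Programs without calls -/

/-- A straight-line program. -/
def block : List Instr → Prog
  | [] => .skip
  | i :: l => .seq (.instr i) (block l)

/-- The effect of a straight-line program. -/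
noncomputable def runList : List Instr → State → State
  | [], σ => σ
  | i :: l, σ => runList l (i.apply σ)

section runList
variable (l : List Instr) (N : ℕ → ℕ) (R : ℕ → ℝ) (a b c : ℕ)

theorem runList_nil (σ : State) : runList [] σ = σ := rfl

theorem runList_natConst : runList (.natConst a c :: l) ⟨N, R⟩
    = runList l ⟨Function.update N a c, R⟩ := rfl

theorem runList_natAdd : runList (.natOp .add a b c :: l) ⟨N, R⟩
    = runList l ⟨Function.update N a (N b + N c), R⟩ := rfl

theorem runList_realConst (q : ℚ) : runList (.realConst a q :: l) ⟨N, R⟩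
    = runList l ⟨N, Function.update R a (q : ℝ)⟩ := rfl

theorem runList_realAdd : runList (.realOp .add a b c :: l) ⟨N, R⟩
    = runList l ⟨N, Function.update R a (R b + R c)⟩ := rfl

theorem runList_realSub : runList (.realOp .sub a b c :: l) ⟨N, R⟩
    = runList l ⟨N, Function.update R a (R b - R c)⟩ := rfl

theorem runList_realMul : runList (.realOp .mul a b c :: l) ⟨N, R⟩
    = runList l ⟨N, Function.update R a (R b * R c)⟩ := rfl

theorem runList_realDiv : runList (.realOp .div a b c :: l) ⟨N, R⟩
    = runList l ⟨N, Function.update R a (R b / R c)⟩ := rfl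

theorem runList_realSqrt : runList (.realSqrt a b :: l) ⟨N, R⟩
    = runList l ⟨N, Function.update R a (√(R b))⟩ := rfl

theorem runList_realLoad : runList (.realLoad a b :: l) ⟨N, R⟩
    = runList l ⟨N, Function.update R a (R (N b))⟩ := rfl

theorem runList_realStore : runList (.realStore a b :: l) ⟨N, R⟩
    = runList l ⟨N, Function.update R (N a) (R b)⟩ := rfl

end runList

section Runs
variable {n d : ℕ} {O : Subroutine n d}

/-- Started in `σ`, the program `P` halts without calls after at most `b` steps in a state that
satisfies `Q`. -/
def Runs (O : Subroutine n d) (P : Prog) (σ : State) (b : ℕ) (Q : State → Prop) : Prop :=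
  ∃ σ' t, Exec O P σ σ' [] t ∧ t ≤ b ∧ Q σ'

theorem exec_block (O : Subroutine n d) (l : List Instr) :
    ∀ σ, Exec O (block l) σ (runList l σ) [] l.length := by
  induction l with
  | nil => exact fun σ => .skip σ
  | cons i l ih =>
    intro σ
    have := Exec.seq (.instr i σ) (ih (i.apply σ))
    rwa [List.append_nil, Nat.add_comm] at this

theorem Runs.block {l : List Instr} {σ : State} {Q : State → Prop} (h : Q (runList l σ)) :
    Runs O (block l) σ l.length Q :=
  ⟨_, _, exec_block O l σ, le_rfl, h⟩

theorem Runs.skip {σ : State} {Q : State → Prop} (h : Q σ) : Runs O .skip σ 0 Q :=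
  ⟨_, _, .skip σ, le_rfl, h⟩

theorem Runs.mono {P : Prog} {σ : State} {b b' : ℕ} {Q Q' : State → Prop}
    (h : Runs O P σ b Q) (hb : b ≤ b') (hQ : ∀ σ', Q σ' → Q' σ') : Runs O P σ b' Q' := by
  obtain ⟨σ', t, h1, h2, h3⟩ := h
  exact ⟨σ', t, h1, h2.trans hb, hQ _ h3⟩

theorem Runs.seq {P P' : Prog} {σ : State} {b b' : ℕ} {Q Q' : State → Prop}
    (h : Runs O P σ b Q) (h' : ∀ σ', Q σ' → Runs O P' σ' b' Q') :
    Runs O (.seq P P') σ (b + b') Q' := by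
  obtain ⟨σ1, t1, h1, h2, h3⟩ := h
  obtain ⟨σ2, t2, g1, g2, g3⟩ := h' _ h3
  exact ⟨σ2, t1 + t2, .seq h1 g1, by omega, g3⟩

theorem Runs.block_seq {l : List Instr} {P : Prog} {σ : State} {b : ℕ} {Q : State → Prop}
    (h : Runs O P (runList l σ) b Q) : Runs O (.seq (SIB.block l) P) σ (l.length + b) Q :=
  Runs.seq (Runs.block (Q := fun σ' => σ' = runList l σ) rfl) fun _ e => e ▸ h

theorem Runs.branch {P P' : Prog} {c : Test} {σ : State} {b : ℕ} {Q : State → Prop}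
    (h : c.Holds σ → Runs O P σ b Q) (h' : ¬ c.Holds σ → Runs O P' σ b Q) :
    Runs O (.branch c P P') σ (1 + b) Q := by
  by_cases hc : c.Holds σ
  · obtain ⟨σ1, t1, h1, h2, h3⟩ := h hc
    exact ⟨σ1, 1 + t1, .branchTrue hc h1, by omega, h3⟩
  · obtain ⟨σ1, t1, h1, h2, h3⟩ := h' hc
    exact ⟨σ1, 1 + t1, .branchFalse hc h1, by omega, h3⟩

/-- The rule for counting loops. -/
theorem Runs.loop {c : Test} {P : Prog} {b m : ℕ} {Inv : ℕ → State → Prop}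
    (hstep : ∀ k < m, ∀ σ, Inv k σ → c.Holds σ ∧ Runs O P σ b (Inv (k + 1)))
    (hend : ∀ σ, Inv m σ → ¬ c.Holds σ) {σ : State} (h0 : Inv 0 σ) :
    Runs O (.loop c P) σ (m * (b + 1) + 1) (Inv m) := by
  -- Induction on the number `j` of remaining iterations.
  have key : ∀ j ≤ m, ∀ σ, Inv (m - j) σ →
      Runs O (.loop c P) σ (j * (b + 1) + 1) (Inv m) := by
    intro j
    induction j with
    | zero => exact fun _ σ h => ⟨σ, 1, .loopDone (hend σ h), by omega, h⟩
    | succ j ih =>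
      intro hj σ h
      obtain ⟨hc, σ1, t1, h1, h2, h3⟩ := hstep _ (by omega) σ h
      rw [show m - (j + 1) + 1 = m - j by omega] at h3
      obtain ⟨σ2, t2, g1, g2, g3⟩ := ih (by omega) σ1 h3
      refine ⟨σ2, 1 + t1 + t2, .loopStep hc h1 g1, ?_, g3⟩
      rw [Nat.succ_mul]; omega
  exact key m le_rfl σ (by rwa [Nat.sub_self])

end Runs

/-! ## The inner loops

Memory layout. Natural-number cells: 0 number of objects, 1 dimension `d`, 2 one, 3 `d + 1`,
4, 5, 6 addresses of the query, of the answer and of the sum of the answers, 7 length of an answer,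
8 flag, 9 and 10 counters, 11, 12, 13 addresses of the current blocks of the query, of the sum and
of the answer, 14 and 15 scratch. Real cells: 0 accuracy, 1 regret parameter, 2 inverse number of
objects, 3 one, 4 three, 5 zero, 6 `h`, 7 `T`, 8 `P`, 9 and 10 coefficients that turn stored weights
into weights, 11 scaling factor, 12 maximal norm, 13 sum of the weights, 14 to 21 scratch, from 32
on the query, the answer and the sum of the answers. -/

/-- Computes the squared norms of a difference before and after the answer, and the inner product
of the difference of the answer with the query. -/
def normProg : Prog :=
  .seq (block [.realConst 14 0, .realConst 15 0, .realConst 16 0, .natConst 10 0])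
    (.loop (.natLt 10 1) (block [
      .natOp .add 14 6 10, .realLoad 17 14, .natOp .add 14 12 10, .realLoad 18 14,
      .natOp .add 14 5 10, .realLoad 19 14, .natOp .add 14 13 10, .realLoad 20 14,
      .natOp .add 14 11 10, .realLoad 21 14,
      .realOp .sub 17 17 18, .realOp .sub 19 19 20, .realOp .mul 21 21 19, .realOp .add 16 16 21,
      .realOp .mul 18 17 17, .realOp .add 14 14 18, .realOp .add 17 17 19, .realOp .mul 17 17 17,
      .realOp .add 15 15 17, .natOp .add 10 10 2]))

/-- The bounds by `32` keep the indirect addresses off the scratch cells. The first two conclusions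
are the frame condition by which later programs know that their data survive. -/
theorem normProg_runs {n d : ℕ} (O : Subroutine n d) (N : ℕ → ℕ) (R : ℕ → ℝ) (h1 : N 1 = d)
    (h2 : N 2 = 1) (h5 : 32 ≤ N 5) (h6 : 32 ≤ N 6) (h11 : 32 ≤ N 11) (h12 : 32 ≤ N 12)
    (h13 : 32 ≤ N 13) :
    Runs O normProg ⟨N, R⟩ (4 + (d * 21 + 1)) fun σ =>
      (∀ c, c ≠ 10 → c ≠ 14 → σ.nat c = N c) ∧
      (∀ c, (c < 14 ∨ 22 ≤ c) → σ.real c = R c) ∧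
      σ.real 14 = ∑ l ∈ Finset.range d, (R (N 6 + l) - R (N 12 + l)) ^ 2 ∧
      σ.real 15 = ∑ l ∈ Finset.range d,
        ((R (N 6 + l) - R (N 12 + l)) + (R (N 5 + l) - R (N 13 + l))) ^ 2 ∧
      σ.real 16 = ∑ l ∈ Finset.range d, R (N 11 + l) * (R (N 5 + l) - R (N 13 + l)) := by
  refine Runs.block_seq ?_
  refine Runs.mono (Runs.loop (m := d) (Inv := fun k σ => σ.nat 10 = k ∧
      (∀ c, c ≠ 10 → c ≠ 14 → σ.nat c = N c) ∧
      (∀ c, (c < 14 ∨ 22 ≤ c) → σ.real c = R c) ∧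
      σ.real 14 = ∑ l ∈ Finset.range k, (R (N 6 + l) - R (N 12 + l)) ^ 2 ∧
      σ.real 15 = ∑ l ∈ Finset.range k,
        ((R (N 6 + l) - R (N 12 + l)) + (R (N 5 + l) - R (N 13 + l))) ^ 2 ∧
      σ.real 16 = ∑ l ∈ Finset.range k, R (N 11 + l) * (R (N 5 + l) - R (N 13 + l)))
      ?_ ?_ ?_) le_rfl fun σ h => h.2
  · rintro k hk ⟨N', R'⟩ ⟨hj, hN, hR, e1, e2, e3⟩
    dsimp only at hj hN hR e1 e2 e3
    refine ⟨?_, Runs.block ?_⟩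
    · simp only [Test.Holds]
      rw [hj, hN 1 (by norm_num) (by norm_num), h1]; exact hk
    · have g2 := hN 2 (by norm_num) (by norm_num)
      have g5 := hN 5 (by norm_num) (by norm_num)
      have g6 := hN 6 (by norm_num) (by norm_num)
      have g11 := hN 11 (by norm_num) (by norm_num)
      have g12 := hN 12 (by norm_num) (by norm_num)
      have g13 := hN 13 (by norm_num) (by norm_num)
      simp (disch := omega) only [runList_natAdd, runList_realLoad, runList_realSub,
        runList_realMul, runList_realAdd, runList_nil, Function.update_self,
        Function.update_of_ne, hj, g2, g5, g6, g11, g12, g13, h2, hR, e1, e2, e3]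
      refine ⟨trivial, fun c a b => ?_, fun c a => ?_, ?_, ?_, ?_⟩
      · simp (disch := omega) only [Function.update_of_ne, hN]
      · simp (disch := omega) only [Function.update_of_ne, hR]
      · rw [Finset.sum_range_succ]; ring
      · rw [Finset.sum_range_succ]; ring
      · rw [Finset.sum_range_succ]
  · rintro σ ⟨hj, hN, -⟩
    simp only [Test.Holds]
    rw [hj, hN 1 (by norm_num) (by norm_num), h1]; exact lt_irrefl _
  · simp (disch := omega) only [runList_natConst, runList_realConst, runList_nil,
      Function.update_self, Function.update_of_ne, Finset.range_zero, Finset.sum_empty,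
      Rat.cast_zero]
    refine ⟨trivial, fun c a b => ?_, fun c a => ?_, trivial, trivial, trivial⟩
    · simp (disch := omega) only [Function.update_of_ne]
    · simp (disch := omega) only [Function.update_of_ne]

/-- Writes a multiple of a difference into the query. -/
def scaleProg : Prog :=
  .loop (.natLt 10 1) (block [
    .natOp .add 14 6 10, .realLoad 17 14, .natOp .add 14 12 10, .realLoad 18 14,
    .realOp .sub 17 17 18, .realOp .mul 17 19 17, .natOp .add 14 11 10, .realStore 14 17,
    .natOp .add 10 10 2])

/-- The block being written ends before both source blocks, so no coordinate is overwritten before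
it is read. -/
theorem scaleProg_runs {n d : ℕ} (O : Subroutine n d) (N : ℕ → ℕ) (R : ℕ → ℝ) (h1 : N 1 = d)
    (h2 : N 2 = 1) (h10 : N 10 = 0) (h11 : 32 ≤ N 11) (h6 : N 11 + d ≤ N 6)
    (h12 : N 11 + d ≤ N 12) :
    Runs O scaleProg ⟨N, R⟩ (d * 10 + 1) fun σ =>
      (∀ c, c ≠ 10 → c ≠ 14 → σ.nat c = N c) ∧
      (∀ c, (c < 17 ∨ 32 ≤ c ∧ (c < N 11 ∨ N 11 + d ≤ c)) → σ.real c = R c) ∧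
      (∀ l < d, σ.real (N 11 + l) = R 19 * (R (N 6 + l) - R (N 12 + l))) := by
  refine Runs.mono (Runs.loop (m := d) (Inv := fun k σ => σ.nat 10 = k ∧
      (∀ c, c ≠ 10 → c ≠ 14 → σ.nat c = N c) ∧ σ.real 19 = R 19 ∧
      (∀ c, (c < 17 ∨ 32 ≤ c ∧ (c < N 11 ∨ N 11 + d ≤ c)) → σ.real c = R c) ∧
      (∀ l < k, σ.real (N 11 + l) = R 19 * (R (N 6 + l) - R (N 12 + l))))
      ?_ ?_ ?_) le_rfl fun σ h => ⟨h.2.1, h.2.2.2.1, h.2.2.2.2⟩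
  · rintro k hk ⟨N', R'⟩ ⟨hj, hN, e1, hR, e2⟩
    dsimp only at hj hN hR e1 e2
    refine ⟨?_, Runs.block ?_⟩
    · simp only [Test.Holds]
      rw [hj, hN 1 (by norm_num) (by norm_num), h1]; exact hk
    · have g2 := hN 2 (by norm_num) (by norm_num)
      have g6 := hN 6 (by norm_num) (by norm_num)
      have g11 := hN 11 (by norm_num) (by norm_num)
      have g12 := hN 12 (by norm_num) (by norm_num)
      simp (disch := omega) only [runList_natAdd, runList_realLoad, runList_realSub,
        runList_realMul, runList_realStore, runList_nil, Function.update_self,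
        Function.update_of_ne, hj, g2, g6, g11, g12, h2, hR, e1]
      refine ⟨trivial, fun c a b => ?_, trivial, fun c a => ?_, fun l hl => ?_⟩
      · simp (disch := omega) only [Function.update_of_ne, hN]
      · simp (disch := omega) only [Function.update_of_ne, hR]
      · rcases eq_or_ne l k with rfl | hlk
        · simp (disch := omega) only [Function.update_self]
        · simp (disch := omega) only [Function.update_of_ne, e2]
  · rintro σ ⟨hj, hN, -⟩
    simp only [Test.Holds]
    rw [hj, hN 1 (by norm_num) (by norm_num), h1]; exact lt_irrefl _
  · exact ⟨h10, fun _ _ _ => rfl, rfl, fun _ _ => rfl, fun l hl => absurd hl (Nat.not_lt_zero l)⟩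

/-- Adds the answer to the sum of the answers and scales the result. -/
def flatProg : Prog :=
  .seq (block [.natConst 10 0])
    (.loop (.natLt 10 7) (block [
      .natOp .add 14 6 10, .realLoad 17 14, .natOp .add 14 5 10, .realLoad 18 14,
      .realOp .add 17 17 18, .realOp .mul 17 11 17, .natOp .add 14 6 10, .realStore 14 17,
      .natOp .add 10 10 2]))

/-- One pass serves all outcomes of a round: the factor in real cell 11 is `1` to continue, `0` to
restart and `1 / (T + 1)` to average. -/
theorem flatProg_runs {n d : ℕ} (O : Subroutine n d) (N : ℕ → ℕ) (R : ℕ → ℝ)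
    (h2 : N 2 = 1) (h5 : 32 ≤ N 5) (h6 : N 6 = N 5 + N 7) :
    Runs O flatProg ⟨N, R⟩ (1 + (N 7 * 10 + 1)) fun σ =>
      (∀ c, c ≠ 10 → c ≠ 14 → σ.nat c = N c) ∧
      (∀ c, (c < 17 ∨ 32 ≤ c ∧ c < N 6) → σ.real c = R c) ∧
      (∀ l < N 7, σ.real (N 6 + l) = R 11 * (R (N 6 + l) + R (N 5 + l))) := by
  refine Runs.block_seq ?_
  refine Runs.mono (Runs.loop (m := N 7) (Inv := fun k σ => σ.nat 10 = k ∧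
      (∀ c, c ≠ 10 → c ≠ 14 → σ.nat c = N c) ∧
      (∀ c, (c < 17 ∨ 32 ≤ c ∧ (c < N 6 ∨ N 6 + k ≤ c)) → σ.real c = R c) ∧
      (∀ l < k, σ.real (N 6 + l) = R 11 * (R (N 6 + l) + R (N 5 + l))))
      ?_ ?_ ?_) le_rfl fun σ h => ⟨h.2.1, fun c hc => h.2.2.1 c (by omega), h.2.2.2⟩
  · rintro k hk ⟨N', R'⟩ ⟨hj, hN, hR, e2⟩
    dsimp only at hj hN hR e2
    refine ⟨?_, Runs.block ?_⟩
    · simp only [Test.Holds]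
      rw [hj, hN 7 (by norm_num) (by norm_num)]; exact hk
    · have g2 := hN 2 (by norm_num) (by norm_num)
      have g6 := hN 6 (by norm_num) (by norm_num)
      have g5 := hN 5 (by norm_num) (by norm_num)
      simp (disch := omega) only [runList_natAdd, runList_realLoad, runList_realAdd,
        runList_realMul, runList_realStore, runList_nil, Function.update_self,
        Function.update_of_ne, hj, g2, g6, g5, h2, hR]
      refine ⟨trivial, fun c a b => ?_, fun c a => ?_, fun l hl => ?_⟩
      · simp (disch := omega) only [Function.update_of_ne, hN]
      · simp (disch := omega) only [Function.update_of_ne, hR]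
      · rcases eq_or_ne l k with rfl | hlk
        · simp (disch := omega) only [Function.update_self]
        · simp (disch := omega) only [Function.update_of_ne, e2]
  · rintro σ ⟨hj, hN, -⟩
    simp only [Test.Holds]
    rw [hj, hN 7 (by norm_num) (by norm_num)]; exact lt_irrefl _
  · simp (disch := omega) only [runList_natConst, runList_nil, Function.update_self]
    refine ⟨trivial, fun c a b => ?_, fun c a => trivial, fun l hl => absurd hl (Nat.not_lt_zero l)⟩
    simp (disch := omega) only [Function.update_of_ne]

/-! ## The passes over the objects -/

/-- The address of the answer. -/
def ansAddr (n d : ℕ) : ℕ := 32 + n * (d + 1)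

/-- The address of the sum of the answers. -/
def sumAddr (n d : ℕ) : ℕ := ansAddr n d + (n + 1) * d

theorem mul_add_le_mul {i k : ℕ} (h : i < k) (d : ℕ) : i * d + d ≤ k * d := by
  rw [← Nat.succ_mul]; exact Nat.mul_le_mul_right d h

/-- The memory cells that keep their values throughout the main loop. -/
structure Setup (n d : ℕ) (ε lam : ℝ) (σ : State) : Prop where
  n0 : σ.nat 0 = n
  n1 : σ.nat 1 = d
  n2 : σ.nat 2 = 1
  n3 : σ.nat 3 = d + 1
  n4 : σ.nat 4 = 32
  n5 : σ.nat 5 = ansAddr n d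
  n6 : σ.nat 6 = sumAddr n d
  n7 : σ.nat 7 = (n + 1) * d
  r0 : σ.real 0 = ε
  r1 : σ.real 1 = lam
  r2 : σ.real 2 = 1 / n
  r3 : σ.real 3 = 1
  r4 : σ.real 4 = 3
  r5 : σ.real 5 = 0

theorem Setup.congr {n d : ℕ} {ε lam : ℝ} {σ τ : State} (h : Setup n d ε lam σ)
    (hN : ∀ c < 8, τ.nat c = σ.nat c) (hR : ∀ c < 6, τ.real c = σ.real c) :
    Setup n d ε lam τ := by
  obtain ⟨a0, a1, a2, a3, a4, a5, a6, a7, b0, b1, b2, b3, b4, b5⟩ := h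
  constructor <;> first
    | rw [hN _ (by norm_num)]; assumption
    | rw [hR _ (by norm_num)]; assumption

/-- The coordinates of the differences of the vector of the min-player stored at `q`. -/
def gapAt (d : ℕ) (R : ℕ → ℝ) (q i l : ℕ) : ℝ := R (q + l) - R (q + d + i * d + l)

/-- Prepares a pass over the objects. -/
def passInit : List Instr :=
  [.natConst 9 0, .natOp .add 11 4 9, .natOp .add 12 6 1, .natOp .add 13 5 1,
    .realConst 12 0, .realConst 13 0]

/-- Moves on to the next object. -/
def passNext : List Instr :=
  [.natOp .add 11 11 3, .natOp .add 12 12 1, .natOp .add 13 13 1, .natOp .add 9 9 2]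

/-- The addresses of the blocks of object `k`. -/
structure AtObject (n d k : ℕ) (N : ℕ → ℕ) : Prop where
  n9 : N 9 = k
  n11 : N 11 = 32 + k * (d + 1)
  n12 : N 12 = sumAddr n d + d + k * d
  n13 : N 13 = ansAddr n d + d + k * d

theorem AtObject.congr {n d k : ℕ} {N N' : ℕ → ℕ} (h : AtObject n d k N)
    (hN : ∀ c, c ≠ 10 → c ≠ 14 → N' c = N c) : AtObject n d k N' := by
  obtain ⟨a, b, c, e⟩ := h
  constructor <;> rw [hN _ (by norm_num) (by norm_num)] <;> assumption

theorem passNext_spec {n d k : ℕ} {N : ℕ → ℕ} {R : ℕ → ℝ} (h : AtObject n d k N) (h1 : N 1 = d)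
    (h2 : N 2 = 1) (h3 : N 3 = d + 1) :
    AtObject n d (k + 1) (runList passNext ⟨N, R⟩).nat ∧
      (∀ c < 9, (runList passNext ⟨N, R⟩).nat c = N c) ∧
      (runList passNext ⟨N, R⟩).real = R := by
  obtain ⟨a, b, c, e⟩ := h
  simp (disch := omega) only [passNext, runList_natAdd, runList_nil, Function.update_of_ne,
    h1, h2, h3, a, b, c, e]
  refine ⟨⟨?_, ?_, ?_, ?_⟩, fun c hc => ?_, trivial⟩ <;>
    simp (disch := omega) only [Function.update_of_ne, Function.update_self, Nat.succ_mul] <;> ring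

theorem passInit_spec {n d : ℕ} {ε lam : ℝ} {N : ℕ → ℕ} {R : ℕ → ℝ}
    (h : Setup n d ε lam ⟨N, R⟩) :
    AtObject n d 0 (runList passInit ⟨N, R⟩).nat ∧
      (∀ c < 9, (runList passInit ⟨N, R⟩).nat c = N c) ∧
      (∀ c, (c < 12 ∨ 14 ≤ c) → (runList passInit ⟨N, R⟩).real c = R c) ∧
      (runList passInit ⟨N, R⟩).real 12 = 0 ∧ (runList passInit ⟨N, R⟩).real 13 = 0 := by
  obtain ⟨a0, a1, a2, a3, a4, a5, a6, a7, b0, b1, b2, b3, b4, b5⟩ := h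
  dsimp only at a1 a4 a5 a6
  simp (disch := omega) only [passInit, runList_natAdd, runList_natConst, runList_realConst,
    runList_nil, Function.update_of_ne, Function.update_self, Rat.cast_zero, a1, a4, a5, a6]
  refine ⟨⟨?_, ?_, ?_, ?_⟩, fun c hc => ?_, fun c hc => ?_, trivial, trivial⟩ <;>
    simp (disch := omega) only [Function.update_of_ne, Function.update_self, zero_mul, add_zero]

/-- The part of the query pass that deals with the weight of an object. -/
def weightList : List Instr :=
  [.realOp .mul 17 6 6, .realOp .add 17 14 17, .realSqrt 17 17, .natOp .add 14 11 1,
    .realLoad 18 14, .realOp .mul 18 9 18, .realOp .add 18 18 10, .realStore 14 18,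
    .realOp .div 19 18 17, .natConst 10 0]

/-- The true weight is an affine function of the stored one, with coefficients in real cells 9 and
10. Normalizing or resetting the weights thus needs no separate pass. -/
theorem weightList_spec {d : ℕ} (N : ℕ → ℕ) (R : ℕ → ℝ) (h1 : N 1 = d) (h11 : 32 ≤ N 11) :
    (∀ c, c ≠ 10 → c ≠ 14 → (runList weightList ⟨N, R⟩).nat c = N c) ∧
      (runList weightList ⟨N, R⟩).nat 10 = 0 ∧
      (∀ c, (c < 17 ∨ 22 ≤ c) → c ≠ N 11 + d → (runList weightList ⟨N, R⟩).real c = R c) ∧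
      (runList weightList ⟨N, R⟩).real (N 11 + d) = R 9 * R (N 11 + d) + R 10 ∧
      (runList weightList ⟨N, R⟩).real 19
        = (R 9 * R (N 11 + d) + R 10) / √(R 14 + R 6 * R 6) := by
  simp (disch := omega) only [weightList, runList_natAdd, runList_natConst, runList_realMul,
    runList_realAdd, runList_realSqrt, runList_realLoad, runList_realStore, runList_realDiv,
    runList_nil, Function.update_of_ne, Function.update_self, h1]
  refine ⟨fun c a b => ?_, trivial, fun c a b => ?_, trivial, trivial⟩ <;>
    simp (disch := omega) only [Function.update_of_ne]

/-- Computes the query. -/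
def queryProg : Prog :=
  .seq (block passInit) (.loop (.natLt 9 0)
    (.seq normProg (.seq (block weightList) (.seq scaleProg (block passNext)))))

theorem queryProg_runs {n d : ℕ} {ε lam : ℝ} (O : Subroutine n d) (N : ℕ → ℕ) (R : ℕ → ℝ)
    (h : Setup n d ε lam ⟨N, R⟩) :
    Runs O queryProg ⟨N, R⟩ (6 + (n * (d * 31 + 21) + 1)) fun σ =>
      (∀ c < 9, σ.nat c = N c) ∧
      (∀ c, (c < 12 ∨ ansAddr n d ≤ c) → σ.real c = R c) ∧
      (∀ i < n, σ.real (32 + i * (d + 1) + d) = R 9 * R (32 + i * (d + 1) + d) + R 10 ∧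
        ∀ l < d, σ.real (32 + i * (d + 1) + l) =
          (R 9 * R (32 + i * (d + 1) + d) + R 10)
            / √(∑ l ∈ Finset.range d, gapAt d R (sumAddr n d) i l ^ 2 + R 6 * R 6)
            * gapAt d R (sumAddr n d) i l) := by
  refine Runs.block_seq ?_
  obtain ⟨s1, s2, s3, -, -⟩ := passInit_spec h
  obtain ⟨a0, a1, a2, a3, a4, a5, a6, a7, b0, b1, b2, b3, b4, b5⟩ := h
  dsimp only at a0 a1 a2 a3 a4 a5 a6 a7
  refine Runs.mono (Runs.loop (m := n) (Inv := fun k σ => AtObject n d k σ.nat ∧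
      (∀ c < 9, σ.nat c = N c) ∧
      (∀ c, (c < 12 ∨ 32 + k * (d + 1) ≤ c) → σ.real c = R c) ∧
      (∀ i < k, σ.real (32 + i * (d + 1) + d) = R 9 * R (32 + i * (d + 1) + d) + R 10 ∧
        ∀ l < d, σ.real (32 + i * (d + 1) + l) =
          (R 9 * R (32 + i * (d + 1) + d) + R 10)
            / √(∑ l ∈ Finset.range d, gapAt d R (sumAddr n d) i l ^ 2 + R 6 * R 6)
            * gapAt d R (sumAddr n d) i l))
      ?_ ?_ ⟨s1, s2, fun c hc => s3 c (by omega), fun i hi => absurd hi (Nat.not_lt_zero i)⟩)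
      le_rfl fun σ h => h.2
  · rintro k hk ⟨N1, R1⟩ ⟨hA, hN, hR, hdone⟩
    have hkn := mul_add_le_mul hk (d + 1)
    have hS : ansAddr n d + d ≤ sumAddr n d := by
      have : (n + 1) * d = n * d + d := Nat.succ_mul n d
      unfold sumAddr; omega
    have hQ : 32 + n * (d + 1) = ansAddr n d := rfl
    dsimp only at hA hN hR hdone
    have g0 := hN 0 (by norm_num)
    have g1 := hN 1 (by norm_num)
    have g2 := hN 2 (by norm_num)
    have g3 := hN 3 (by norm_num)
    have g5 := hN 5 (by norm_num)
    have g6 := hN 6 (by norm_num)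
    have g11 := hA.n11
    have g12 := hA.n12
    have g13 := hA.n13
    refine ⟨?_, Runs.mono (Runs.seq (normProg_runs O N1 R1 (g1.trans a1) (g2.trans a2)
      (by omega) (by omega) (by omega) (by omega) (by omega)) ?_)
      (b := _ + (10 + ((d * 10 + 1) + 4))) (by omega) fun _ h => h⟩
    · simp only [Test.Holds]
      rw [hA.n9, g0, a0]; exact hk
    -- Only the squared norm of the summed difference is needed; the other two results involve the
    -- previous answer and are dropped.
    rintro ⟨N2, R2⟩ ⟨hN2, hR2, e1, -, -⟩
    dsimp only at hN2 hR2 e1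
    have hA2 := hA.congr hN2
    have g1' := hN2 1 (by norm_num) (by norm_num)
    refine Runs.block_seq (l := weightList) ?_
    obtain ⟨w1, w2, w3, w4, w5⟩ :=
      weightList_spec (d := d) N2 R2 (by omega) (by rw [hA2.n11]; omega)
    generalize runList weightList ⟨N2, R2⟩ = σ3 at *
    obtain ⟨N3, R3⟩ := σ3
    dsimp only at w1 w2 w3 w4 w5
    have hA3 := hA2.congr w1
    have hN3 : ∀ c, c ≠ 10 → c ≠ 14 → N3 c = N1 c := fun c a b => by rw [w1 c a b, hN2 c a b]
    have k1 := hN3 1 (by norm_num) (by norm_num)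
    have k2 := hN3 2 (by norm_num) (by norm_num)
    have k3 := hN3 3 (by norm_num) (by norm_num)
    have k6 := hN3 6 (by norm_num) (by norm_num)
    have k11 := hA3.n11
    have k12 := hA3.n12
    refine Runs.seq (scaleProg_runs O N3 R3 (by omega) (by omega) w2 (by omega) (by omega)
      (by omega)) ?_
    rintro ⟨N4, R4⟩ ⟨hN4, hR4, e4⟩
    dsimp only at hN4 hR4 e4
    refine Runs.block (l := passNext) ?_
    have hN4' : ∀ c, c ≠ 10 → c ≠ 14 → N4 c = N1 c := fun c a b => by rw [hN4 c a b, hN3 c a b]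
    obtain ⟨q1, q2, q3⟩ := passNext_spec (R := R4) (hA3.congr hN4)
      ((hN4' 1 (by norm_num) (by norm_num)).trans (by omega))
      ((hN4' 2 (by norm_num) (by norm_num)).trans (by omega))
      ((hN4' 3 (by norm_num) (by norm_num)).trans (by omega))
    have hk1 : (k + 1) * (d + 1) = k * (d + 1) + (d + 1) := Nat.succ_mul _ _
    have hfar : ∀ c, (c < 12 ∨ 32 ≤ c ∧ (c < 32 + k * (d + 1) ∨ 32 + (k + 1) * (d + 1) ≤ c)) →
        R4 c = R1 c := by
      intro c hc
      rw [hR4 c (by omega), w3 c (by omega) (by rw [hA2.n11]; omega), hR2 c (by omega)]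
    rw [hA2.n11] at w4 w5
    have hp : R2 9 * R2 (32 + k * (d + 1) + d) + R2 10
        = R 9 * R (32 + k * (d + 1) + d) + R 10 := by
      rw [hR2 _ (by omega), hR2 _ (by omega), hR2 _ (by omega), hR _ (by omega),
        hR _ (by omega), hR _ (by omega)]
    have hh : R2 6 = R 6 := by rw [hR2 _ (by omega), hR _ (by omega)]
    have hgap : ∀ l, R1 (N1 6 + l) - R1 (N1 12 + l) = gapAt d R (sumAddr n d) k l := by
      intro l
      rw [hR _ (by omega), hR _ (by omega), g12, g6, a6]; rfl
    simp only [hgap] at e1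
    refine ⟨q1, fun c hc => ?_, fun c hc => ?_, fun i hi => ?_⟩
    · rw [q2 c hc, hN4' c (by omega) (by omega), hN c hc]
    · rw [q3, hfar c (by omega), hR c (by omega)]
    · rw [q3]
      rcases Nat.lt_succ_iff_lt_or_eq.1 hi with hi | rfl
      · have hik := mul_add_le_mul hi (d + 1)
        refine ⟨?_, fun l hl => ?_⟩
        · rw [hfar _ (by omega)]; exact (hdone i hi).1
        · rw [hfar _ (by omega)]; exact (hdone i hi).2 l hl
      · refine ⟨?_, fun l hl => ?_⟩
        · rw [hR4 _ (by omega), w4, hp]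
        · have := e4 l hl
          rw [k11] at this
          rw [this, w5, hp, e1, hh, k6, k12, g6, a6]
          congr 1
          rw [w3 _ (by omega) (by rw [hA2.n11]; omega),
            w3 _ (by omega) (by rw [hA2.n11]; omega),
            hR2 _ (by omega), hR2 _ (by omega), hR _ (by omega), hR _ (by omega)]
          rfl
  · rintro σ ⟨hA, hN, -⟩
    simp only [Test.Holds]
    rw [hA.n9, hN 0 (by norm_num), a0]; exact lt_irrefl _

/-- The part of the update pass that computes the new weight of an object. -/
def updateList : List Instr :=
  [.realOp .add 8 8 16, .realOp .mul 17 6 6, .realOp .add 18 14 17, .realSqrt 18 18,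
    .realOp .add 19 15 17, .realSqrt 19 19, .realOp .sub 19 19 18, .realOp .div 19 19 6,
    .realOp .mul 18 19 19, .realOp .add 19 18 19, .realOp .add 19 19 3,
    .natOp .add 14 11 1, .realLoad 18 14, .realOp .mul 18 18 19, .realStore 14 18,
    .realOp .add 13 13 18, .realSqrt 15 15]

theorem updateList_spec {d : ℕ} (N : ℕ → ℕ) (R : ℕ → ℝ) (h1 : N 1 = d) (h11 : 32 ≤ N 11)
    (hr3 : R 3 = 1) {v u : ℝ} (hv : v = (√(R 15 + R 6 * R 6) - √(R 14 + R 6 * R 6)) / R 6)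
    (hu : u = R (N 11 + d) * (v * v + v + 1)) :
    (∀ c, c ≠ 14 → (runList updateList ⟨N, R⟩).nat c = N c) ∧
      (∀ c, (c < 13 ∧ c ≠ 8 ∨ 22 ≤ c) → c ≠ N 11 + d →
        (runList updateList ⟨N, R⟩).real c = R c) ∧
      (runList updateList ⟨N, R⟩).real (N 11 + d) = u ∧
      (runList updateList ⟨N, R⟩).real 8 = R 8 + R 16 ∧
      (runList updateList ⟨N, R⟩).real 13 = R 13 + u ∧
      (runList updateList ⟨N, R⟩).real 15 = √(R 15) := by
  subst hv hu
  simp (disch := omega) only [updateList, runList_natAdd, runList_realMul, runList_realSub,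
    runList_realAdd, runList_realSqrt, runList_realLoad, runList_realStore, runList_realDiv,
    runList_nil, Function.update_of_ne, Function.update_self, h1, hr3]
  refine ⟨fun c a => ?_, fun c a b => ?_, trivial, trivial, trivial, trivial⟩ <;>
    simp (disch := omega) only [Function.update_of_ne]

/-- Updates the maximal norm. -/
def maxProg : Prog := .branch (.realLe 15 12) .skip (block [.realOp .add 12 15 5])

/-- Real cell 5 holds zero, so the addition acts as a copy. -/
theorem maxProg_runs {n d : ℕ} (O : Subroutine n d) (N : ℕ → ℕ) (R : ℕ → ℝ) (h5 : R 5 = 0) :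
    Runs O maxProg ⟨N, R⟩ 2 fun σ => σ.nat = N ∧ (∀ c, c ≠ 12 → σ.real c = R c) ∧
      σ.real 12 = max (R 12) (R 15) := by
  refine Runs.branch (b := 1) (fun hc => ?_) (fun hc => ?_)
  · refine (Runs.skip ?_).mono (Nat.zero_le _) fun _ h => h
    exact ⟨rfl, fun _ _ => rfl, (max_eq_left hc).symm⟩
  · refine Runs.block ?_
    simp only [Test.Holds, not_le] at hc
    simp (disch := omega) only [runList_realAdd, runList_nil, Function.update_self, h5, add_zero]
    refine ⟨trivial, fun c a => ?_, (max_eq_right hc.le).symm⟩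
    simp (disch := omega) only [Function.update_of_ne]

/-- Processes the answer. -/
def updateProg : Prog :=
  .seq (block passInit) (.loop (.natLt 9 0)
    (.seq normProg (.seq (block updateList) (.seq maxProg (block passNext)))))

section quantities
variable (n d : ℕ) (R : ℕ → ℝ) (i : ℕ)

/-- The squared norm of the difference before the answer. -/
noncomputable def oldSq : ℝ := ∑ l ∈ Finset.range d, gapAt d R (sumAddr n d) i l ^ 2

/-- The squared norm of the difference after the answer. -/
noncomputable def newSq : ℝ :=
  ∑ l ∈ Finset.range d, (gapAt d R (sumAddr n d) i l + gapAt d R (ansAddr n d) i l) ^ 2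

/-- The contribution of an object to the payoff. -/
noncomputable def dotAt : ℝ :=
  ∑ l ∈ Finset.range d, R (32 + i * (d + 1) + l) * gapAt d R (ansAddr n d) i l

/-- The relative increment of the smoothed norm. -/
noncomputable def incrAt : ℝ := (√(newSq n d R i + R 6 * R 6) - √(oldSq n d R i + R 6 * R 6)) / R 6

/-- The new weight before normalization. -/
noncomputable def rawAt : ℝ :=
  R (32 + i * (d + 1) + d) * (incrAt n d R i * incrAt n d R i + incrAt n d R i + 1)

end quantities

/-- The maximal norm is described as a least upper bound among nonnegative numbers, because its cell
starts at zero; this matches the definition of the product norm. -/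
theorem updateProg_runs {n d : ℕ} {ε lam : ℝ} (O : Subroutine n d) (N : ℕ → ℕ) (R : ℕ → ℝ)
    (h : Setup n d ε lam ⟨N, R⟩) :
    Runs O updateProg ⟨N, R⟩ (6 + (n * (d * 21 + 29) + 1)) fun σ =>
      (∀ c < 9, σ.nat c = N c) ∧
      (∀ c, (c < 12 ∧ c ≠ 8 ∨ ansAddr n d ≤ c) → σ.real c = R c) ∧
      (∀ i < n, σ.real (32 + i * (d + 1) + d) = rawAt n d R i) ∧
      σ.real 8 = R 8 + ∑ i ∈ Finset.range n, dotAt n d R i ∧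
      σ.real 13 = ∑ i ∈ Finset.range n, rawAt n d R i ∧
      (∀ i < n, √(newSq n d R i) ≤ σ.real 12) ∧
      (∀ B, 0 ≤ B → (∀ i < n, √(newSq n d R i) ≤ B) → σ.real 12 ≤ B) := by
  refine Runs.block_seq ?_
  obtain ⟨s1, s2, s3, s4, s5⟩ := passInit_spec h
  obtain ⟨a0, a1, a2, a3, a4, a5, a6, a7, b0, b1, b2, b3, b4, b5⟩ := h
  dsimp only at a0 a1 a2 a3 a4 a5 a6 a7 b3 b5
  have hS : ansAddr n d + (n * d + d) = sumAddr n d := by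
    rw [← Nat.succ_mul]; rfl
  have hQ : 32 + n * (d + 1) = ansAddr n d := rfl
  refine Runs.mono (Runs.loop (m := n) (Inv := fun k σ => AtObject n d k σ.nat ∧
      (∀ c < 9, σ.nat c = N c) ∧
      (∀ c, (c < 12 ∧ c ≠ 8 ∨ 32 + k * (d + 1) ≤ c) → σ.real c = R c) ∧
      (∀ i < k, σ.real (32 + i * (d + 1) + d) = rawAt n d R i) ∧
      σ.real 8 = R 8 + ∑ i ∈ Finset.range k, dotAt n d R i ∧
      σ.real 13 = ∑ i ∈ Finset.range k, rawAt n d R i ∧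
      (∀ i < k, √(newSq n d R i) ≤ σ.real 12) ∧
      (∀ B, 0 ≤ B → (∀ i < k, √(newSq n d R i) ≤ B) → σ.real 12 ≤ B))
      ?_ ?_ ⟨s1, s2, fun c hc => s3 c (by omega), fun i hi => absurd hi (Nat.not_lt_zero i),
        by rw [s3 8 (by norm_num)]; simp, by rw [s5]; simp,
        fun i hi => absurd hi (Nat.not_lt_zero i), fun B hB _ => s4 ▸ hB⟩)
      le_rfl fun σ h => h.2
  · rintro k hk ⟨N1, R1⟩ ⟨hA, hN, hR, hdone, hP, hZ, hM, hM'⟩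
    have hkn := mul_add_le_mul hk (d + 1)
    have hkd := mul_add_le_mul hk d
    dsimp only at hA hN hR hdone hP hZ hM hM'
    have g0 := hN 0 (by norm_num)
    have g1 := hN 1 (by norm_num)
    have g2 := hN 2 (by norm_num)
    have g3 := hN 3 (by norm_num)
    have g5 := hN 5 (by norm_num)
    have g6 := hN 6 (by norm_num)
    have g11 := hA.n11
    have g12 := hA.n12
    have g13 := hA.n13
    refine ⟨?_, Runs.mono (Runs.seq (normProg_runs O N1 R1 (g1.trans a1) (g2.trans a2)
      (by omega) (by omega) (by omega) (by omega) (by omega)) ?_)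
      (b := _ + (17 + (2 + 4))) (by omega) fun _ h => h⟩
    · simp only [Test.Holds]
      rw [hA.n9, g0, a0]; exact hk
    rintro ⟨N2, R2⟩ ⟨hN2, hR2, e1, e2, e3⟩
    dsimp only at hN2 hR2 e1 e2 e3
    have hA2 := hA.congr hN2
    have hsum : ∀ l, R1 (N1 6 + l) - R1 (N1 12 + l) = gapAt d R (sumAddr n d) k l := by
      intro l
      rw [hR _ (by omega), hR _ (by omega), g12, g6, a6]; rfl
    have hans : ∀ l, R1 (N1 5 + l) - R1 (N1 13 + l) = gapAt d R (ansAddr n d) k l := by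
      intro l
      rw [hR _ (by omega), hR _ (by omega), g13, g5, a5]; rfl
    have hq : ∀ l, R1 (N1 11 + l) = R (32 + k * (d + 1) + l) := by
      intro l
      rw [hR _ (by omega), g11]
    simp only [hsum, hans, hq] at e1 e2 e3
    have g1' := hN2 1 (by norm_num) (by norm_num)
    have hh : R2 6 = R 6 := by rw [hR2 _ (by omega), hR _ (by omega)]
    have hw : R2 (N2 11 + d) = R (32 + k * (d + 1) + d) := by
      rw [hA2.n11, hR2 _ (by omega), hR _ (by omega)]
    refine Runs.block_seq (l := updateList) ?_
    obtain ⟨w1, w2, w3, w4, w5, w6⟩ :=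
      updateList_spec (d := d) N2 R2 (by omega) (by rw [hA2.n11]; omega)
        (by rw [hR2 _ (by omega), hR _ (by omega), b3]) (v := incrAt n d R k) (u := rawAt n d R k)
        (by rw [e1, e2, hh]; rfl) (by rw [hw]; rfl)
    generalize runList updateList ⟨N2, R2⟩ = σ3 at *
    obtain ⟨N3, R3⟩ := σ3
    dsimp only at w1 w2 w3 w4 w5 w6
    rw [hA2.n11] at w2 w3
    refine Runs.seq (maxProg_runs O N3 R3 (by
      rw [w2 _ (by omega) (by omega), hR2 _ (by omega), hR _ (by omega), b5])) ?_
    rintro ⟨N4, R4⟩ ⟨hN4, hR4, e4⟩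
    dsimp only at hN4 hR4 e4
    subst hN4
    refine Runs.block (l := passNext) ?_
    have hN4' : ∀ c, c ≠ 10 → c ≠ 14 → N4 c = N1 c := fun c a b => by rw [w1 c b, hN2 c a b]
    obtain ⟨q1, q2, q3⟩ := passNext_spec (R := R4) (hA.congr hN4')
      ((hN4' 1 (by norm_num) (by norm_num)).trans (by omega))
      ((hN4' 2 (by norm_num) (by norm_num)).trans (by omega))
      ((hN4' 3 (by norm_num) (by norm_num)).trans (by omega))
    have hk1 : (k + 1) * (d + 1) = k * (d + 1) + (d + 1) := Nat.succ_mul _ _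
    have hfar : ∀ c, (c < 12 ∧ c ≠ 8 ∨ 32 ≤ c ∧ c ≠ 32 + k * (d + 1) + d) →
        R4 c = R1 c := by
      intro c hc
      rw [hR4 c (by omega), w2 c (by omega) (by omega), hR2 c (by omega)]
    have hnew : R3 15 = √(newSq n d R k) := by rw [w6, e2]; rfl
    rw [hnew, w2 12 (by omega) (by omega), hR2 12 (by omega)] at e4
    refine ⟨q1, fun c hc => ?_, ?_⟩
    · rw [q2 c hc, hN4' c (by omega) (by omega), hN c hc]
    rw [q3]
    refine ⟨fun c hc => ?_, fun i hi => ?_, ?_, ?_, fun i hi => ?_, fun B hB hi => ?_⟩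
    · rw [hfar c (by omega), hR c (by omega)]
    · rcases Nat.lt_succ_iff_lt_or_eq.1 hi with hi | rfl
      · have hik := mul_add_le_mul hi (d + 1)
        rw [hfar _ (by omega)]; exact hdone i hi
      · rw [hR4 _ (by omega), w3]
    · rw [hR4 _ (by omega), w4, hR2 8 (by omega), hP, e3, Finset.sum_range_succ, add_assoc]; rfl
    · rw [hR4 _ (by omega), w5, hR2 13 (by omega), hZ, Finset.sum_range_succ]
    · rw [e4]
      rcases Nat.lt_succ_iff_lt_or_eq.1 hi with hi | rfl
      · exact (hM i hi).trans (le_max_left _ _)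
      · exact le_max_right _ _
    · rw [e4]
      exact max_le (hM' B hB fun i h => hi i (by omega)) (hi k (by omega))
  · rintro σ ⟨hA, hN, -⟩
    simp only [Test.Holds]
    rw [hA.n9, hN 0 (by norm_num), a0]; exact lt_irrefl _

/-- Decides whether to stop, to continue or to restart. -/
def decideProg : Prog :=
  .seq (block [.realOp .add 7 7 3, .realOp .add 17 3 0, .realOp .mul 17 17 8])
    (.branch (.realLe 12 17) (block [.natConst 8 1, .realOp .div 11 3 7])
      (.seq (block [.realOp .mul 18 1 6, .realOp .mul 18 4 18, .realOp .add 18 18 8])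
        (.branch (.realLe 12 18)
          (block [.realOp .add 11 3 5, .realOp .div 9 3 13, .realOp .add 10 5 5])
          (block [.realOp .div 17 12 7, .realOp .add 6 6 6, .realOp .add 6 6 17,
            .realConst 7 0, .realConst 8 0, .realConst 9 0, .realOp .add 10 2 5,
            .realConst 11 0]))))

/-- The three alternatives are stopping, continuing and restarting. Cells 9 and 10 receive `1 / Z`
and `0` to continue, with `Z` the sum of the raw weights, or `0` and `1 / n` to restart uniformly.
-/
theorem decideProg_runs {n d : ℕ} {ε lam : ℝ} (O : Subroutine n d) (N : ℕ → ℕ) (R : ℕ → ℝ)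
    (h : Setup n d ε lam ⟨N, R⟩) :
    Runs O decideProg ⟨N, R⟩ 16 fun σ =>
      (∀ c, c ≠ 8 → σ.nat c = N c) ∧
      (∀ c, (c < 6 ∨ 12 ≤ c ∧ c < 17 ∨ 19 ≤ c) → σ.real c = R c) ∧
      ((R 12 ≤ (1 + ε) * R 8 ∧ σ.nat 8 = 1 ∧ σ.real 7 = R 7 + 1 ∧ σ.real 11 = 1 / (R 7 + 1)) ∨
       ((1 + ε) * R 8 < R 12 ∧ R 12 ≤ 3 * (lam * R 6) + R 8 ∧ σ.nat 8 = N 8 ∧ σ.real 6 = R 6 ∧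
          σ.real 7 = R 7 + 1 ∧ σ.real 8 = R 8 ∧ σ.real 9 = 1 / R 13 ∧ σ.real 10 = 0 ∧
          σ.real 11 = 1) ∨
       ((1 + ε) * R 8 < R 12 ∧ 3 * (lam * R 6) + R 8 < R 12 ∧ σ.nat 8 = N 8 ∧
          σ.real 6 = R 6 + R 6 + R 12 / (R 7 + 1) ∧ σ.real 7 = 0 ∧ σ.real 8 = 0 ∧
          σ.real 9 = 0 ∧ σ.real 10 = 1 / n ∧ σ.real 11 = 0)) := by
  obtain ⟨a0, a1, a2, a3, a4, a5, a6, a7, b0, b1, b2, b3, b4, b5⟩ := h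
  dsimp only at b0 b1 b2 b3 b4 b5
  refine Runs.mono (Runs.block_seq (b := 13) ?_) (by norm_num) fun _ h => h
  simp (disch := omega) only [runList_realAdd, runList_realMul, runList_nil,
    Function.update_of_ne, Function.update_self, b0, b3]
  refine Runs.branch (b := 12) (fun hc => ?_) (fun hc => ?_)
  · refine Runs.mono (Runs.block ?_) (by norm_num) fun _ h => h
    simp (disch := omega) only [Test.Holds, Function.update_of_ne, Function.update_self] at hc
    simp (disch := omega) only [runList_realDiv, runList_natConst, runList_nil,
      Function.update_of_ne, Function.update_self, b3]
    refine ⟨fun c hc => ?_, fun c hc => ?_, Or.inl ⟨hc, trivial, trivial, trivial⟩⟩ <;>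
      simp (disch := omega) only [Function.update_of_ne]
  · simp (disch := omega) only [Test.Holds, Function.update_of_ne, Function.update_self,
      not_le] at hc
    refine Runs.mono (Runs.block_seq (b := 9) ?_) (by norm_num) fun _ h => h
    simp (disch := omega) only [runList_realAdd, runList_realMul, runList_nil,
      Function.update_of_ne, Function.update_self, b1, b4]
    refine Runs.branch (b := 8) (fun hc' => ?_) (fun hc' => ?_)
    · refine Runs.mono (Runs.block ?_) (by norm_num) fun _ h => h
      simp (disch := omega) only [Test.Holds, Function.update_of_ne, Function.update_self] at hc'
      simp (disch := omega) only [runList_realDiv, runList_realAdd, runList_nil,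
        Function.update_of_ne, Function.update_self, b3, b5]
      refine ⟨fun c hc => trivial, fun c hc => ?_, Or.inr (Or.inl ⟨hc, hc', trivial, trivial,
        trivial, trivial, trivial, add_zero _, add_zero _⟩)⟩
      simp (disch := omega) only [Function.update_of_ne]
    · refine Runs.mono (Runs.block ?_) (by norm_num) fun _ h => h
      simp (disch := omega) only [Test.Holds, Function.update_of_ne, Function.update_self,
        not_le] at hc'
      simp (disch := omega) only [runList_realDiv, runList_realAdd, runList_realConst, runList_nil,
        Function.update_of_ne, Function.update_self, b2, b5, Rat.cast_zero]
      refine ⟨fun c hc => trivial, fun c hc => ?_, Or.inr (Or.inr ⟨hc, hc', trivial, trivial,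
        trivial, trivial, trivial, add_zero _, trivial⟩)⟩
      simp (disch := omega) only [Function.update_of_ne]

/-! ## Vectors in the memory -/

section HoldsMin
variable {n d : ℕ}

/-- The vector `a` of the min-player is stored from the address `q` on. -/
def HoldsMin (R : ℕ → ℝ) (q : ℕ) (a : MinVec n d) : Prop :=
  (∀ j : Fin d, R (q + j) = a.1 j) ∧ ∀ (i : Fin n) (j : Fin d), R (q + d + i * d + j) = a.2 i j

theorem add_mul_add_lt (i : Fin n) (j : Fin d) : d + i * d + j < (n + 1) * d := by
  have := mul_add_le_mul i.2 d
  have : (n + 1) * d = n * d + d := Nat.succ_mul n d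
  have := j.2
  omega

theorem fin_lt_succ_mul (j : Fin d) : (j : ℕ) < (n + 1) * d := by
  have : (n + 1) * d = n * d + d := Nat.succ_mul n d
  have := j.2
  omega

theorem writeMin_of_lt_or_le (m : ℕ → ℝ) (q : ℕ) (a : MinVec n d) {c : ℕ}
    (hc : c < q ∨ q + (n + 1) * d ≤ c) : writeMin m q a c = m c :=
  dif_neg (by omega)

theorem holdsMin_writeMin (m : ℕ → ℝ) (q : ℕ) (a : MinVec n d) :
    HoldsMin (writeMin m q a) q a := by
  refine ⟨fun j => ?_, fun i j => ?_⟩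
  · have h : q ≤ q + j ∧ q + j - q < (n + 1) * d := by
      have := fin_lt_succ_mul (n := n) j; omega
    have h1 : (⟨q + j - q, h.2⟩ : Fin ((n + 1) * d)).divNat = 0 :=
      Fin.ext (by simp [Fin.divNat, Nat.div_eq_of_lt j.2])
    have h2 : (⟨q + j - q, h.2⟩ : Fin ((n + 1) * d)).modNat = j :=
      Fin.ext (by simp [Fin.modNat, Nat.mod_eq_of_lt j.2])
    rw [writeMin, dif_pos h, cells, h1, h2, Fin.cons_zero]
  · have h : q ≤ q + d + i * d + j ∧ q + d + i * d + j - q < (n + 1) * d := by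
      have := add_mul_add_lt i j; omega
    -- The centre occupies block zero, so `v i` is block `i + 1`.
    have e : q + d + i * d + j - q = j + d * (i + 1) := by
      rw [mul_add, mul_comm d]; omega
    have hd : 0 < d := j.pos
    have h1 : (⟨q + d + i * d + j - q, h.2⟩ : Fin ((n + 1) * d)).divNat = i.succ :=
      Fin.ext (by
        simp only [Fin.divNat, e, Nat.add_mul_div_left _ _ hd, Nat.div_eq_of_lt j.2, Fin.val_succ,
          zero_add])
    have h2 : (⟨q + d + i * d + j - q, h.2⟩ : Fin ((n + 1) * d)).modNat = j :=
      Fin.ext (by simp only [Fin.modNat, e, Nat.add_mul_mod_self_left, Nat.mod_eq_of_lt j.2])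
    rw [writeMin, dif_pos h, cells, h1, h2, Fin.cons_succ]

theorem HoldsMin.congr {R R' : ℕ → ℝ} {q : ℕ} {a : MinVec n d} (h : HoldsMin R q a)
    (hR : ∀ c, q ≤ c → c < q + (n + 1) * d → R' c = R c) : HoldsMin R' q a := by
  refine ⟨fun j => ?_, fun i j => ?_⟩
  · have := fin_lt_succ_mul (n := n) j
    rw [hR _ (by omega) (by omega)]; exact h.1 j
  · have := add_mul_add_lt i j
    rw [hR _ (by omega) (by omega)]; exact h.2 i j

theorem HoldsMin.add_smul {R R' : ℕ → ℝ} {q q' : ℕ} {a b : MinVec n d} {γ : ℝ}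
    (ha : HoldsMin R q a) (hb : HoldsMin R q' b)
    (h : ∀ l < (n + 1) * d, R' (q + l) = γ * (R (q + l) + R (q' + l))) :
    HoldsMin R' q (γ • (a + b)) := by
  refine ⟨fun j => ?_, fun i j => ?_⟩
  · rw [h _ (fin_lt_succ_mul j), ha.1, hb.1]
    simp [mul_add]
  · have := h _ (add_mul_add_lt i j)
    simp only [← add_assoc] at this
    rw [this, ha.2, hb.2]
    simp [mul_add]

variable {R : ℕ → ℝ}

theorem HoldsMin.gapAt_eq {q : ℕ} {a : MinVec n d} (h : HoldsMin R q a) (i : Fin n) (l : Fin d) :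
    gapAt d R q i l = gap a i l := by
  rw [gapAt, h.1, h.2]; rfl

theorem dotAt_eq {a : MinVec n d} (ha : HoldsMin R (ansAddr n d) a) (i : Fin n) {y : Pt d} (hy : ∀ l : Fin d, R (32 + i * (d + 1) + l) = y l) :
    dotAt n d R i = inner ℝ (gap a i) y := by
  rw [dotAt, PiLp.inner_apply, Finset.sum_range]
  exact Finset.sum_congr rfl fun l _ => by rw [ha.gapAt_eq, hy]; simp

variable {s a : MinVec n d} (hs : HoldsMin R (sumAddr n d) s) (ha : HoldsMin R (ansAddr n d) a)
include hs

theorem oldSq_eq (i : Fin n) : oldSq n d R i = ‖gap s i‖ ^ 2 := by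
  rw [oldSq, EuclideanSpace.real_norm_sq_eq, Finset.sum_range]
  exact Finset.sum_congr rfl fun l _ => by rw [hs.gapAt_eq]

include ha

theorem newSq_eq (i : Fin n) : newSq n d R i = ‖gap s i + gap a i‖ ^ 2 := by
  rw [newSq, EuclideanSpace.real_norm_sq_eq, Finset.sum_range]
  exact Finset.sum_congr rfl fun l _ => by rw [hs.gapAt_eq, ha.gapAt_eq]; rfl

end HoldsMin

/-! ## An iteration of the main loop -/

section iteration
variable {n d : ℕ}

/-- The memory represents the state `s` of the game. -/
structure Rep (ε lam : ℝ) (s : GameState n d) (σ : State) : Prop where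
  setup : Setup n d ε lam σ
  flag : σ.nat 8 = 0
  h : σ.real 6 = s.h
  T : σ.real 7 = s.T
  P : σ.real 8 = s.P
  p : ∀ i : Fin n, σ.real 9 * σ.real (32 + i * (d + 1) + d) + σ.real 10 = s.p i
  acc : HoldsMin σ.real (sumAddr n d) s.acc

/-- The memory holds the result. -/
structure Finished (s : GameState n d) (a : MinVec n d) (σ : State) : Prop where
  n2 : σ.nat 2 = 1
  n6 : σ.nat 6 = sumAddr n d
  flag : σ.nat 8 = 1
  T : σ.real 7 = s.T + 1
  norm : σ.real 12 = s.newNorm a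
  acc : HoldsMin σ.real (sumAddr n d) ((s.T + 1)⁻¹ • (s.acc + a))

/-- The body of the main loop. -/
def iterProg : Prog :=
  .seq queryProg (.seq (.call 4 5) (.seq updateProg (.seq decideProg flatProg)))

/-- The link between machine and game: the memory contents after each pass are identified with the
query, the raw weights, the payoff and the norm of the abstract round. -/
theorem iterProg_exec (hn : 0 < n) (O : Subroutine n d) {ε lam : ℝ} {s : GameState n d} {σ : State}
    (hrep : Rep ε lam s σ) :
    ∃ σ' t, Exec O iterProg σ σ' [s.query] t ∧
      t ≤ n * (d * 62 + 50) + d * 10 + 34 + O.time s.query ∧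
      ((s.newNorm (O.answer s.query) ≤ (1 + ε) * s.newPayoff (O.answer s.query) ∧
          Finished s (O.answer s.query) σ') ∨
        ((1 + ε) * s.newPayoff (O.answer s.query) < s.newNorm (O.answer s.query) ∧
          s.newNorm (O.answer s.query) ≤ 3 * (lam * s.h) + s.newPayoff (O.answer s.query) ∧
          Rep ε lam (s.continued (O.answer s.query)) σ') ∨
        (3 * (lam * s.h) + s.newPayoff (O.answer s.query) < s.newNorm (O.answer s.query) ∧
          Rep ε lam (s.restarted (O.answer s.query)) σ')) := by
  obtain ⟨N, R⟩ := σ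
  obtain ⟨hset, hflag, hh, hT, hP, hp, hacc⟩ := hrep
  dsimp only at hflag hh hT hP hp hacc
  obtain ⟨⟨N1, R1⟩, t1, x1, le1, hN1, hR1, hq⟩ := queryProg_runs O N R hset
  dsimp only at hN1 hR1 hq
  have hSA : sumAddr n d = ansAddr n d + (n + 1) * d := rfl
  have hAA : ansAddr n d = 32 + n * (d + 1) := rfl
  have hset1 : Setup n d ε lam ⟨N1, R1⟩ :=
    hset.congr (fun c hc => hN1 c (by omega)) (fun c hc => hR1 c (by omega))
  have hold : ∀ i : Fin n, √(∑ l ∈ Finset.range d, gapAt d R (sumAddr n d) i l ^ 2 + R 6 * R 6)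
      = smoothNorm s.h (gap s.acc i) := fun i => by
    have := oldSq_eq hacc i
    rw [oldSq] at this
    rw [this, hh]; rfl
  have hq1 : ∀ i : Fin n, R1 (32 + i * (d + 1) + d) = s.p i := fun i => by
    rw [(hq i i.2).1, hp]
  have hq2 : ∀ (i : Fin n) (l : Fin d), R1 (32 + i * (d + 1) + l) = (s.query i).1 l := fun i l => by
    rw [(hq i i.2).2 l l.2, hp, hold, hacc.gapAt_eq]; rfl
  have hread : readMax n d R1 (N1 4) = s.query := by
    have h4 : N1 4 = 32 := hset1.n4
    funext i
    rw [readMax, h4]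
    refine Prod.ext ?_ (hq1 i)
    ext l
    exact hq2 i l
  have x2 := Exec.call (O := O) 4 5 ⟨N1, R1⟩
  simp only [hread] at x2
  generalize O.answer s.query = a at *
  have h5 : N1 5 = ansAddr n d := hset1.n5
  rw [h5] at x2
  have hR2 : ∀ c, (c < ansAddr n d ∨ sumAddr n d ≤ c) →
      writeMin R1 (ansAddr n d) a c = R1 c := fun c hc => writeMin_of_lt_or_le _ _ _ hc
  have hans2 := holdsMin_writeMin R1 (ansAddr n d) a
  generalize writeMin R1 (ansAddr n d) a = R2 at *
  have hset2 : Setup n d ε lam ⟨N1, R2⟩ :=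
    hset1.congr (fun c hc => rfl) (fun c hc => hR2 c (by omega))
  have hacc2 : HoldsMin R2 (sumAddr n d) s.acc :=
    hacc.congr fun c h1 h2 => by rw [hR2 c (by omega), hR1 c (by omega)]
  have hblock : ∀ i : Fin n, ∀ l ≤ d, R2 (32 + i * (d + 1) + l) = R1 (32 + i * (d + 1) + l) :=
    fun i l hl => hR2 _ (by have := mul_add_le_mul i.2 (d + 1); omega)
  obtain ⟨⟨N3, R3⟩, t3, x3, le3, hN3, hR3, hraw, hP3, hZ3, hM3, hM3'⟩ :=
    updateProg_runs O N1 R2 hset2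
  dsimp only at hN3 hR3 hraw hP3 hZ3 hM3 hM3'
  have hset3 : Setup n d ε lam ⟨N3, R3⟩ :=
    hset2.congr (fun c hc => hN3 c (by omega)) (fun c hc => hR3 c (by omega))
  have hh2 : R2 6 = s.h := by rw [hR2 _ (by omega), hR1 _ (by omega), hh]
  have hrawAt : ∀ i : Fin n, rawAt n d R2 i = s.raw a i := fun i => by
    rw [rawAt, incrAt, newSq_eq hacc2 hans2, oldSq_eq hacc2, hh2, hblock i d le_rfl, hq1,
      GameState.raw, sq (s.incr a i)]
    rfl
  have hnew : s.newNorm a = R3 12 := by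
    have hb : ∀ i : Fin n, ‖gap (s.acc + a) i‖ = √(newSq n d R2 i) := fun i => by
      rw [newSq_eq hacc2 hans2, Real.sqrt_sq (norm_nonneg _), gap_add]; rfl
    refine le_antisymm ?_ ?_
    · refine (pi_norm_le_iff_of_nonneg ?_).2 fun i => hb i ▸ hM3 i i.2
      exact (Real.sqrt_nonneg _).trans (hM3 0 hn)
    · exact hM3' _ (norm_nonneg _) fun i hi => hb ⟨i, hi⟩ ▸ norm_le_pi_norm (gap (s.acc + a)) ⟨i, hi⟩
  have hpay : R3 8 = s.newPayoff a := by
    rw [hP3, hR2 _ (by omega), hR1 _ (by omega), hP, GameState.newPayoff, payoff_eq,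
      Finset.sum_range]
    congr 1
    refine Finset.sum_congr rfl fun i _ => dotAt_eq hans2 i fun l => ?_
    rw [hblock i l l.2.le, hq2]
  have hZ : R3 13 = ∑ i, s.raw a i := by
    rw [hZ3, Finset.sum_range]
    exact Finset.sum_congr rfl fun i _ => hrawAt i
  have hT3 : R3 7 = s.T := by rw [hR3 _ (by omega), hR2 _ (by omega), hR1 _ (by omega), hT]
  have hh3 : R3 6 = s.h := by rw [hR3 _ (by omega), hh2]
  have hflag3 : N3 8 = 0 := by rw [hN3 _ (by omega), hN1 _ (by omega), hflag]
  have hacc3 : HoldsMin R3 (sumAddr n d) s.acc := hacc2.congr fun c h1 h2 => hR3 c (by omega)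
  have hans3 : HoldsMin R3 (ansAddr n d) a := hans2.congr fun c h1 h2 => hR3 c (by omega)
  obtain ⟨⟨N4, R4⟩, t4, x4, le4, hN4, hR4, hcases⟩ := decideProg_runs O N3 R3 hset3
  dsimp only at hN4 hR4 hcases
  have hset4 : Setup n d ε lam ⟨N4, R4⟩ :=
    hset3.congr (fun c hc => hN4 c (by omega)) (fun c hc => hR4 c (by omega))
  have hacc4 : HoldsMin R4 (sumAddr n d) s.acc := hacc3.congr fun c h1 h2 => hR4 c (by omega)
  have hans4 : HoldsMin R4 (ansAddr n d) a := hans3.congr fun c h1 h2 => hR4 c (by omega)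
  have k2 : N4 2 = 1 := hset4.n2
  have k5 : N4 5 = ansAddr n d := hset4.n5
  have k6 : N4 6 = sumAddr n d := hset4.n6
  have k7 : N4 7 = (n + 1) * d := hset4.n7
  obtain ⟨⟨N5, R5⟩, t5, x5, le5, hN5, hR5, hflat⟩ :=
    flatProg_runs O N4 R4 k2 (by omega) (by omega)
  dsimp only at hN5 hR5 hflat
  rw [k5, k6, k7] at hflat
  rw [k6] at hR5
  have hset5 : Setup n d ε lam ⟨N5, R5⟩ :=
    hset4.congr (fun c hc => hN5 c (by omega) (by omega)) (fun c hc => hR5 c (by omega))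
  have hacc5 : HoldsMin R5 (sumAddr n d) (R4 11 • (s.acc + a)) := hacc4.add_smul hans4 hflat
  have hw5 : ∀ i : Fin n, R5 (32 + i * (d + 1) + d) = s.raw a i := fun i => by
    have := mul_add_le_mul i.2 (d + 1)
    rw [hR5 _ (by omega), hR4 _ (by omega), hraw i i.2, hrawAt]
  have hflag5 : N5 8 = N4 8 := hN5 8 (by omega) (by omega)
  have hr : ∀ c < 17, R5 c = R4 c := fun c hc => hR5 c (by omega)
  refine ⟨⟨N5, R5⟩, _, x1.seq (x2.seq (x3.seq (x4.seq x5))), ?_, ?_⟩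
  · have e : (n + 1) * d = n * d + d := Nat.succ_mul n d
    rw [k7, e] at le5
    have e1 : n * (d * 31 + 21) = 31 * (n * d) + 21 * n := by ring
    have e2 : n * (d * 21 + 29) = 21 * (n * d) + 29 * n := by ring
    have e3 : n * (d * 62 + 50) = 62 * (n * d) + 50 * n := by ring
    omega
  rw [← hnew, hpay, hh3, hT3] at hcases
  rcases hcases with ⟨c1, c2, c3, c4⟩ | ⟨c1, c2, c3, c4, c5, c6, c7, c8, c9⟩ |
    ⟨-, c2, c3, c4, c5, c6, c7, c8, c9⟩
  · refine Or.inl ⟨c1, hset5.n2, hset5.n6, hflag5.trans c2, (hr 7 (by omega)).trans c3, ?_, ?_⟩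
    · exact (hr 12 (by omega)).trans ((hR4 12 (by omega)).trans hnew.symm)
    · rw [← one_div, ← c4]; exact hacc5
  · refine Or.inr (Or.inl ⟨c1, c2, hset5, hflag5.trans (c3.trans hflag3),
      (hr 6 (by omega)).trans c4, (hr 7 (by omega)).trans c5, (hr 8 (by omega)).trans c6,
      fun i => ?_, ?_⟩)
    · change R5 9 * R5 _ + R5 10 = s.raw a i / ∑ k, s.raw a k
      rw [hr 9 (by omega), hr 10 (by omega), c7, c8, hw5, hZ]; ring
    · rw [c9, one_smul] at hacc5; exact hacc5
  · refine Or.inr (Or.inr ⟨c2, hset5, hflag5.trans (c3.trans hflag3),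
      (hr 6 (by omega)).trans c4, (hr 7 (by omega)).trans c5, (hr 8 (by omega)).trans c6,
      fun i => ?_, ?_⟩)
    · change R5 9 * R5 _ + R5 10 = 1 / n
      rw [hr 9 (by omega), hr 10 (by omega), c7, c8]; ring
    · rw [c9, zero_smul] at hacc5; exact hacc5

end iteration

/-! ## The main loop -/

/-- The last elements of a list are indexed by a set of positions. -/
theorem exists_finset_sum_suffix {α M : Type*} [AddCommMonoid M] (pre l : List α) (f : α → M) :
    ∃ J : Finset (Fin (pre ++ l).length), J.card = l.length ∧
      ∑ k ∈ J, f ((pre ++ l).get k) = (l.map f).sum := by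
  let e : Fin l.length ↪ Fin (pre ++ l).length :=
    ⟨fun k => ⟨pre.length + k, by rw [List.length_append]; omega⟩, fun a b h => by
      simpa [Fin.ext_iff] using h⟩
  refine ⟨Finset.univ.map e, by simp, ?_⟩
  rw [Finset.sum_map, ← Fin.sum_univ_fun_getElem]
  exact Finset.sum_congr rfl fun k _ => by
    change f (pre ++ l)[pre.length + k] = f l[k]
    rw [List.getElem_append_right (Nat.le_add_right _ _)]; simp

section mainLoop
variable {n d : ℕ}

/-- Induction on the number of rounds still allowed. The list `suf` holds the queries of the last
epoch, the only ones averaged, and `pre` those of abandoned epochs. -/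
theorem mainLoop_exec {Ω : Fin n → Set (Pt d)} (hne : ∀ i, (Ω i).Nonempty)
    (hc : ∀ i, IsCompact (Ω i)) (hconv : ∀ i, Convex ℝ (Ω i)) (hr : 0 < optRadius Ω)
    {O : Subroutine n d} {b : ℝ} (hb : 0 ≤ b)
    (hO : ∀ y ∈ maxSet n d, IsBestResponse Ω y (O.answer y) ∧ (O.time y : ℝ) ≤ b)
    {ε lam : ℝ} (hε : 0 < ε) (hε1 : ε ≤ 1) (hlam : 1 + Real.log n ≤ lam) (fuel : ℕ) :
    ∀ (s : GameState n d) (L : List (MaxVec n d)) (N : ℕ) (σ : State),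
      s.Valid Ω O.answer lam ε (optRadius Ω) (Metric.diam (⋃ i, Ω i)) L N →
      Rep ε lam s σ →
      300 * lam * ((Metric.diam (⋃ i, Ω i) / optRadius Ω) ^ 2 / ε ^ 2) < N + fuel →
      ∃ (σ' : State) (L' pre suf : List (MaxVec n d)) (t : ℕ),
        Exec O (.loop (.natLt 8 2) iterProg) σ σ' L' t ∧
        (t : ℝ) ≤ fuel * (n * (d * 62 + 50) + d * 10 + 35 + b) + 1 ∧
        (∀ y ∈ L', y ∈ maxSet n d) ∧ L ++ L' = pre ++ suf ∧ suf ≠ [] ∧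
        σ'.nat 6 = sumAddr n d ∧
        IsApproxSolution Ω ε ((suf.length : ℝ)⁻¹ • (suf.map O.answer).sum.1)
          (σ'.real 12 / σ'.real 7) ∧
        HoldsMin σ'.real (sumAddr n d) ((suf.length : ℝ)⁻¹ • (suf.map O.answer).sum) := by
  have hn : 0 < n := (two_le_of_optRadius_pos hne hr).trans_lt' Nat.zero_lt_two
  have hlam1 : 1 ≤ lam := by have := Real.log_natCast_nonneg n; linarith
  induction fuel with
  -- No rounds left would contradict the bound on the total number of rounds.
  | zero =>
    intro s L N σ hv _ hfuel
    have := hv.total_le_bound (by linarith) hε hr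
    push_cast at hfuel
    linarith
  | succ fuel ih =>
    intro s L N σ hv hrep hfuel
    have hquery := hv.query_mem
    obtain ⟨hbest, htime⟩ := hO _ hquery
    have ha : ∀ i, (O.answer s.query).2 i ∈ Ω i := hbest.1.2
    have hgap := norm_gap_le_diam hc hbest.1
    have hpay := payoff_le_optRadius hne hn hquery hbest
    have hrD : optRadius Ω ≤ Metric.diam (⋃ i, Ω i) := (optRadius_le_norm_gap ha).trans hgap
    have hc : (Test.natLt 8 2).Holds σ := by
      have h1 := hrep.flag
      have h2 := hrep.setup.n2
      simp only [Test.Holds]; omega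
    obtain ⟨σ1, t1, x1, le1, hcases⟩ := iterProg_exec hn O hrep
    have le1' : (t1 : ℝ) ≤ n * (d * 62 + 50) + d * 10 + 34 + b := by
      have : (t1 : ℝ) ≤ n * (d * 62 + 50) + d * 10 + 34 + O.time s.query := by
        exact_mod_cast le1
      linarith
    have hX : (0 : ℝ) ≤ n * (d * 62 + 50) + d * 10 + 35 + b := by positivity
    have hfuel' : 300 * lam * ((Metric.diam (⋃ i, Ω i) / optRadius Ω) ^ 2 / ε ^ 2)
        < (N + 1 : ℕ) + fuel := by push_cast at hfuel ⊢; linarith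
    rcases hcases with ⟨hdone, hfin⟩ | ⟨hcont, hgood, hrep'⟩ | ⟨hbad, hrep'⟩
    · have hdone' : ¬ (Test.natLt 8 2).Holds σ1 := by
        have h1 := hfin.flag
        have h2 := hfin.n2
        simp only [Test.Holds]; omega
      have hlen : ((L ++ [s.query]).length : ℝ) = s.T + 1 := by simp [hv.T_eq]
      have hsum : ((L ++ [s.query]).map O.answer).sum = s.acc + O.answer s.query := by
        simp [hv.acc_eq]
      refine ⟨σ1, [s.query], [], L ++ [s.query], 1 + t1 + 1,
        .loopStep hc x1 (.loopDone hdone'), ?_, ?_, rfl, by simp, hfin.n6, ?_, ?_⟩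
      · push_cast
        nlinarith [mul_nonneg (Nat.cast_nonneg (α := ℝ) fuel) hX]
      · simpa using hquery
      · rw [hlen, hsum, hfin.norm, hfin.T]
        exact hv.isApproxSolution hconv ha hε hpay hdone
      · rw [hlen, hsum]; exact hfin.acc
    · obtain ⟨σ2, L2, pre, suf, t2, x2, le2, hL2, hsplit, hrest⟩ := ih _ _ _ σ1
        (hv.continued hconv hn hε hε1 (by linarith) (fun i _ => ha i) hgap hpay hcont hgood)
        hrep' hfuel'
      refine ⟨σ2, [s.query] ++ L2, pre, suf, 1 + t1 + t2, .loopStep hc x1 x2, ?_, ?_, ?_, hrest⟩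
      · push_cast; linarith
      · simpa using ⟨hquery, hL2⟩
      · rw [← List.append_assoc]; exact hsplit
    · obtain ⟨σ2, L2, pre, suf, t2, x2, le2, hL2, hsplit, hrest⟩ := ih _ _ _ σ1
        (hv.restarted hne hconv hlam hn hε hε1 hr hrD ha hgap hbad) hrep' hfuel'
      -- After a restart, the queries of the failed epoch join the discarded prefix.
      refine ⟨σ2, [s.query] ++ L2, L ++ [s.query] ++ pre, suf, 1 + t1 + t2,
        .loopStep hc x1 x2, ?_, ?_, ?_, hrest⟩
      · push_cast; linarith
      · simpa using ⟨hquery, hL2⟩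
      · rw [List.nil_append] at hsplit
        rw [hsplit]; simp

end mainLoop

/-! ## Initialization -/

/-- Computes the addresses and the constants. -/
def layoutProg : Prog :=
  .seq (block [.natConst 2 1, .natOp .add 3 1 2, .natConst 4 32, .natConst 5 32, .realConst 3 1,
      .realConst 4 3])
    (.seq (.loop (.natLt 9 0) (block [.natOp .add 5 5 3, .natOp .add 7 7 1, .realOp .add 2 2 3,
      .natOp .add 9 9 2]))
    (block [.natOp .add 7 7 1, .natOp .add 6 5 7, .realOp .div 2 3 2, .realOp .add 10 2 5,
      .natConst 15 1, .realConst 1 1]))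

/-- Natural-number cells cannot be multiplied and cannot be converted to reals, so `n * (d + 1)`, `n
* d` and the real number `n` are built by `n` repeated additions. -/
theorem layoutProg_runs {n d : ℕ} (O : Subroutine n d) (ε : ℝ) :
    Runs O layoutProg (initial n d ε) (6 + ((n * 5 + 1) + 6)) fun σ =>
      Setup n d ε 1 σ ∧ σ.nat 15 = 1 ∧ σ.nat 8 = 0 ∧
      (∀ c, (6 ≤ c ∧ c ≠ 10) → σ.real c = 0) ∧ σ.real 10 = 1 / n := by
  refine Runs.block_seq ?_
  simp (disch := omega) only [initial, runList_natAdd, runList_natConst, runList_realConst,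
    runList_nil, Function.update_of_ne, Function.update_self]
  refine Runs.seq (Runs.loop (m := n) (Inv := fun k σ =>
    σ.nat 0 = n ∧ σ.nat 1 = d ∧ σ.nat 2 = 1 ∧ σ.nat 3 = d + 1 ∧ σ.nat 4 = 32 ∧
    σ.nat 5 = 32 + k * (d + 1) ∧ σ.nat 7 = k * d ∧ σ.nat 8 = 0 ∧ σ.nat 9 = k ∧
    σ.real 0 = ε ∧ σ.real 2 = k ∧ σ.real 3 = 1 ∧ σ.real 4 = 3 ∧
    (∀ c, 5 ≤ c → σ.real c = 0)) ?_ ?_ ?_) ?_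
  · rintro k hk ⟨N, R⟩ ⟨a0, a1, a2, a3, a4, a5, a7, a8, a9, b0, b2, b3, b4, b5⟩
    dsimp only at a0 a1 a2 a3 a4 a5 a7 a8 a9 b0 b2 b3 b4 b5
    refine ⟨?_, Runs.block ?_⟩
    · simp only [Test.Holds]; rw [a9, a0]; exact hk
    · simp (disch := omega) only [runList_natAdd, runList_realAdd,
        runList_nil, Function.update_of_ne, Function.update_self, a0, a1, a2, a3, a4, a5, a7, a8,
        a9, b0, b2, b3, b4, true_and]
      refine ⟨by rw [Nat.succ_mul, add_assoc], by rw [Nat.succ_mul], by push_cast; rfl,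
        fun c hc => ?_⟩
      simp (disch := omega) only [Function.update_of_ne, b5]
  · rintro σ ⟨a0, -, -, -, -, -, -, -, a9, -⟩
    simp only [Test.Holds]; rw [a9, a0]; exact lt_irrefl _
  · simp (disch := omega) only [Function.update_of_ne, Function.update_self, Rat.cast_one,
      Rat.cast_ofNat]
    refine ⟨rfl, rfl, trivial, rfl, trivial, by simp, by simp, rfl, rfl, rfl, by simp, trivial,
      trivial, fun c hc => ?_⟩
    simp (disch := omega) only [Function.update_of_ne, if_neg]
  · rintro ⟨N, R⟩ ⟨a0, a1, a2, a3, a4, a5, a7, a8, a9, b0, b2, b3, b4, b5⟩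
    dsimp only at a0 a1 a2 a3 a4 a5 a7 a8 a9 b0 b2 b3 b4 b5
    refine Runs.block ?_
    have e7 : n * d + d = (n + 1) * d := (Nat.succ_mul n d).symm
    simp (disch := omega) only [runList_natAdd, runList_realAdd, runList_realDiv,
      runList_natConst, runList_realConst,
      runList_nil, Function.update_of_ne, Function.update_self, a1, a5, a7, a8, b2, b3, b5, e7, add_zero, Rat.cast_one]
    refine ⟨?_, trivial, trivial, fun c hc => ?_, trivial⟩
    · constructor <;> simp (disch := omega) only [Function.update_of_ne, Function.update_self,
        a0, a1, a2, a3, a4, a5, b0, b3, b4, b5] <;> rfl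
    · simp (disch := omega) only [Function.update_of_ne, b5]

/-- Computes the regret parameter. -/
def logProg : Prog :=
  .loop (.natLt 15 0) (block [.natOp .add 15 15 15, .realOp .add 1 1 3])

/-- A counter is doubled until it reaches `n`; the number of doublings replaces the logarithm. -/
theorem logProg_runs {n d : ℕ} {ε : ℝ} (O : Subroutine n d) (N : ℕ → ℕ) (R : ℕ → ℝ)
    (h : Setup n d ε 1 ⟨N, R⟩) (h15 : N 15 = 1) :
    Runs O logProg ⟨N, R⟩ (Nat.clog 2 n * 3 + 1) fun σ =>
      Setup n d ε (1 + Nat.clog 2 n) σ ∧ (∀ c, c ≠ 15 → σ.nat c = N c) ∧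
      (∀ c, c ≠ 1 → σ.real c = R c) := by
  refine Runs.mono (Runs.loop (m := Nat.clog 2 n) (Inv := fun k σ =>
    Setup n d ε (1 + k) σ ∧ (∀ c, c ≠ 15 → σ.nat c = N c) ∧
      (∀ c, c ≠ 1 → σ.real c = R c) ∧ σ.nat 15 = 2 ^ k) ?_ ?_
      ⟨by simpa using h, fun _ _ => rfl, fun _ _ => rfl, h15⟩) le_rfl
    fun σ h => ⟨h.1, h.2.1, h.2.2.1⟩
  · rintro k hk ⟨N1, R1⟩ ⟨hs, hN, hR, h1⟩
    have k0 := hs.n0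
    obtain ⟨a0, a1, a2, a3, a4, a5, a6, a7, b0, b1, b2, b3, b4, b5⟩ := hs
    dsimp only at a0 a1 a2 a3 a4 a5 a6 a7 b0 b1 b2 b3 b4 b5 hN hR h1 k0
    refine ⟨?_, Runs.block ?_⟩
    · simp only [Test.Holds]; rw [h1, k0]
      exact (Nat.lt_clog_iff_pow_lt Nat.one_lt_two).1 hk
    · simp (disch := omega) only [runList_natAdd, runList_realAdd,
        runList_nil, Function.update_self, h1, b1, b3]
      refine ⟨?_, fun c hc => ?_, fun c hc => ?_, by rw [pow_succ, mul_two]⟩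
      · constructor <;> simp (disch := omega) only [Function.update_of_ne, Function.update_self,
          a0, a1, a2, a3, a4, a5, a6, a7, b0, b2, b3, b4, b5]
        push_cast; ring
      · simp (disch := omega) only [Function.update_of_ne, hN]
      · simp (disch := omega) only [Function.update_of_ne, hR]
  · rintro σ ⟨hs, -, -, h1⟩
    simp only [Test.Holds]; rw [h1, hs.n0, not_lt]
    exact Nat.le_pow_clog Nat.one_lt_two n

/-- The first bound uses `log 2 < 1`. The second uses `2 ^ (clog 2 n - 1) < n`, with `n ≥ 2` to
absorb the additive constants into `log n`. -/
theorem one_add_log_le_clog {n : ℕ} (hn : 2 ≤ n) :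
    1 + Real.log n ≤ 1 + Nat.clog 2 n ∧ (1 + Nat.clog 2 n : ℝ) ≤ 5 * Real.log n := by
  have hn0 : (0 : ℝ) < n := by positivity
  have hl2 := Real.log_two_gt_d9
  have hl2' := Real.log_two_lt_d9
  have hln : Real.log 2 ≤ Real.log n := Real.log_le_log (by norm_num) (by exact_mod_cast hn)
  constructor
  · have h1 : (n : ℝ) ≤ 2 ^ Nat.clog 2 n := by exact_mod_cast Nat.le_pow_clog Nat.one_lt_two n
    have h2 := Real.log_le_log hn0 h1
    rw [Real.log_pow] at h2
    have : (0 : ℝ) ≤ Nat.clog 2 n := Nat.cast_nonneg _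
    nlinarith
  · obtain ⟨m, hm⟩ : ∃ m, Nat.clog 2 n = m + 1 :=
      Nat.exists_eq_succ_of_ne_zero (Nat.clog_pos Nat.one_lt_two hn).ne'
    have h1 : 2 ^ m < n := (Nat.lt_clog_iff_pow_lt Nat.one_lt_two).1 (by omega)
    have h2 : ((2 : ℝ) ^ m) ≤ n := by exact_mod_cast h1.le
    have h3 := Real.log_le_log (by positivity) h2
    rw [Real.log_pow] at h3
    rw [hm]; push_cast
    have : (0 : ℝ) ≤ m := Nat.cast_nonneg _
    nlinarith

/-- The algorithm. -/
def intersectingBallProg : Prog :=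
  .seq layoutProg (.seq logProg (.seq (.loop (.natLt 8 2) iterProg)
    (block [.natConst 9 0, .natOp .add 0 6 9, .realOp .div 0 12 7])))

/-- Zeroed memory already represents an epoch with `h = 0`. There the query directions and the
payoff vanish while the new norm is at least `r* > 0`, so the first round fails and sets `h` to that
norm; no separate estimate of the scale is needed. -/
theorem rep_start {n d : ℕ} {ε lam : ℝ} {σ : State} (h : Setup n d ε lam σ) (h8 : σ.nat 8 = 0)
    (hR : ∀ c, (6 ≤ c ∧ c ≠ 10) → σ.real c = 0) (h10 : σ.real 10 = 1 / n) :
    Rep ε lam (GameState.start n d 0) σ where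
  setup := h
  flag := h8
  h := hR 6 (by norm_num)
  T := hR 7 (by norm_num)
  P := hR 8 (by norm_num)
  p := fun i => by rw [hR 9 (by norm_num), h10, zero_mul, zero_add]; rfl
  acc := by
    have : 32 ≤ sumAddr n d := by unfold sumAddr ansAddr; omega
    exact ⟨fun j => hR _ (by omega), fun i j => hR _ (by omega)⟩

/-- Here `ρ` stands for `R² / ε²`. As `n ≤ n d`, `d ≤ n d`, `ρ ≥ 1` and `lg ≥ 1 / 2`, all
lower-order costs fit under the main term; the constants are generous. -/
theorem time_bound {n d fuel ρ lg S c : ℝ} (hn : 2 ≤ n) (hd : 1 ≤ d) (hρ : 1 ≤ ρ)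
    (hlg : 1 / 2 ≤ lg) (hS : 0 ≤ S) (hc : 0 ≤ c) (hfuel : fuel ≤ 1510 * (lg * ρ)) :
    20 + 8 * n + (fuel * (n * (d * 62 + 50) + d * 10 + 35 + c * S) + 1)
      ≤ (10 ^ 6 + 10 ^ 4 * c) * (ρ * (S + n * d) * lg) := by
  have hnd : n ≤ n * d := by nlinarith
  have hdn : d ≤ n * d := by nlinarith
  have h1 : n * (d * 62 + 50) + d * 10 + 35 + c * S ≤ (200 + c) * (S + n * d) := by
    nlinarith [mul_nonneg hc (show 0 ≤ n * d by linarith)]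
  have hG : 1 / 2 ≤ lg * ρ := by nlinarith
  have hX : 1 ≤ S + n * d := by linarith
  have h2 : fuel * (n * (d * 62 + 50) + d * 10 + 35 + c * S)
      ≤ 1510 * (lg * ρ) * ((200 + c) * (S + n * d)) :=
    mul_le_mul hfuel h1 (by positivity) (by positivity)
  have h3 : 20 + 8 * n + 1 ≤ 58 * (lg * ρ * (S + n * d)) := by nlinarith
  have h4 : 0 ≤ lg * ρ * (S + n * d) := by positivity
  nlinarith [mul_nonneg hc h4]

theorem intersectingBallProg_exec {c : ℝ} (hc0 : 0 ≤ c) {n d : ℕ} {Ω : Fin n → Set (Pt d)}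
    (hne : ∀ i, (Ω i).Nonempty) (hc : ∀ i, IsCompact (Ω i)) (hconv : ∀ i, Convex ℝ (Ω i))
    (hr : 0 < optRadius Ω) {O : Subroutine n d} {S : ℝ} (hS : 0 ≤ S)
    (hO : ∀ y ∈ maxSet n d, IsBestResponse Ω y (O.answer y) ∧ (O.time y : ℝ) ≤ c * S)
    {ε : ℝ} (hε : 0 < ε) (hε1 : ε ≤ 1) :
    ∃ (σ : State) (L : List (MaxVec n d)) (t : ℕ),
      Exec O intersectingBallProg (initial n d ε) σ L t ∧
      IsApproxSolution Ω ε (σ.outCentre d) σ.outRadius ∧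
      (t : ℝ) ≤ (10 ^ 6 + 10 ^ 4 * c) * ((Metric.diam (⋃ i, Ω i) / optRadius Ω) ^ 2 *
        (S + n * d) * Real.log n / ε ^ 2) ∧
      (∀ y ∈ L, y ∈ maxSet n d) ∧
      ∃ J : Finset (Fin L.length), J.Nonempty ∧
        σ.outCentre d = (J.card : ℝ)⁻¹ • ∑ k ∈ J, (O.answer (L.get k)).1 := by
  have hn2 := two_le_of_optRadius_pos hne hr
  have hn : 0 < n := by omega
  have hd := dim_pos_of_optRadius_pos hne hr
  obtain ⟨hlam, hlam5⟩ := one_add_log_le_clog hn2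
  obtain ⟨⟨N1, R1⟩, t1, x1, le1, hs1, h15, h8, hR1, h10⟩ := layoutProg_runs O ε
  dsimp only at h15 h8 hR1 h10
  obtain ⟨σ2, t2, x2, le2, hs2, hN2, hR2⟩ := logProg_runs O N1 R1 hs1 h15
  generalize hlam_def : (1 + Nat.clog 2 n : ℝ) = lam at *
  have hlog : 0.69 ≤ Real.log n := by
    have := Real.log_le_log (x := 2) (y := n) (by norm_num) (by exact_mod_cast hn2)
    linarith [Real.log_two_gt_d9]
  have hlam1 : 1 ≤ lam := by linarith
  have hrep : Rep ε lam (GameState.start n d 0) σ2 :=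
    rep_start hs2 ((hN2 8 (by norm_num)).trans h8)
      (fun k hk => (hR2 k (by omega)).trans (hR1 k hk)) ((hR2 10 (by norm_num)).trans h10)
  have hv : (GameState.start n d 0).Valid Ω O.answer lam ε (optRadius Ω)
      (Metric.diam (⋃ i, Ω i)) [] 0 :=
    GameState.Valid.start hne hn (by linarith) le_rfl (by positivity) (by simp)
  have hrD : optRadius Ω ≤ Metric.diam (⋃ i, Ω i) := by
    have hbest := (hO _ hv.query_mem).1
    exact (optRadius_le_norm_gap hbest.1.2).trans (norm_gap_le_diam hc hbest.1)
  set ρ := (Metric.diam (⋃ i, Ω i) / optRadius Ω) ^ 2 / ε ^ 2 with hρ_def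
  have hρ : 1 ≤ ρ := by
    have h1 : 1 ≤ Metric.diam (⋃ i, Ω i) / optRadius Ω := (one_le_div hr).2 hrD
    rw [hρ_def, ← div_pow]
    exact one_le_pow₀ ((one_le_div hε).2 (hε1.trans h1))
  obtain ⟨σ3, L3, pre, suf, t3, x3, le3, hL3, hsplit, hsuf, h6, happ, hacc⟩ :=
    mainLoop_exec hne hc hconv hr (mul_nonneg hc0 hS) hO hε hε1 hlam
      -- One more than the floor makes the round budget strictly exceed the bound.
      (⌊300 * lam * ρ⌋₊ + 1) _ [] 0 σ2 hv hrep (by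
        have := Nat.lt_floor_add_one (300 * lam * ρ)
        push_cast; linarith)
  have x4 := exec_block O [.natConst 9 0, .natOp .add 0 6 9, .realOp .div 0 12 7] σ3
  obtain ⟨N3, R3⟩ := σ3
  dsimp only at h6 happ hacc
  simp (disch := omega) only [runList_natAdd, runList_natConst, runList_realDiv, runList_nil,
    Function.update_of_ne, Function.update_self, h6, add_zero] at x4
  rw [List.nil_append] at hsplit
  have hlast : (t1 : ℝ) + (t2 + (t3 + 3))
      ≤ (10 ^ 6 + 10 ^ 4 * c) * (ρ * (S + n * d) * Real.log n) := by
    have hclog : Nat.clog 2 n ≤ n := Nat.clog_le_of_le_pow n.lt_two_pow_self.le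
    have le1' : (t1 : ℝ) ≤ 13 + 5 * n := by
      have : t1 ≤ 13 + 5 * n := by omega
      exact_mod_cast this
    have le2' : (t2 : ℝ) ≤ 1 + 3 * n := by
      have : t2 ≤ 1 + 3 * n := by omega
      exact_mod_cast this
    have hfuel : ((⌊300 * lam * ρ⌋₊ + 1 : ℕ) : ℝ) ≤ 1510 * (Real.log n * ρ) := by
      have h1 := Nat.floor_le (a := 300 * lam * ρ) (by positivity)
      have h2 : lam * ρ ≤ 5 * Real.log n * ρ := mul_le_mul_of_nonneg_right hlam5 (by linarith)
      have h3 : 1 ≤ lam * ρ := one_le_mul_of_one_le_of_one_le hlam1 hρ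
      push_cast
      linarith
    have := time_bound (n := n) (d := d) (lg := Real.log n) (by exact_mod_cast hn2)
      (by exact_mod_cast hd) hρ (by linarith) hS hc0 hfuel
    linarith
  have hcentre : State.outCentre d ⟨Function.update (Function.update N3 9 0) 0 (sumAddr n d),
      Function.update R3 0 (R3 12 / R3 7)⟩
      = (suf.length : ℝ)⁻¹ • (suf.map O.answer).sum.1 := by
    ext j
    simp only [State.outCentre, Function.update_self]
    rw [Function.update_of_ne (by unfold sumAddr ansAddr; omega), hacc.1 j]
    rfl
  refine ⟨_, _, _, x1.seq (x2.seq (x3.seq x4)), ?_, ?_, ?_, ?_⟩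
  · rw [hcentre]; simpa only [State.outRadius, Function.update_self] using happ
  · have e : (Metric.diam (⋃ i, Ω i) / optRadius Ω) ^ 2 * (S + n * d) * Real.log n / ε ^ 2
        = ρ * (S + n * d) * Real.log n := by rw [hρ_def]; ring
    rw [e]
    push_cast [List.length_cons, List.length_nil]
    norm_num at hlast ⊢
    linarith
  · simpa using hL3
  · rw [List.nil_append, List.nil_append, List.append_nil, hsplit]
    obtain ⟨J, hJ, hJs⟩ := exists_finset_sum_suffix pre suf fun y => (O.answer y).1
    refine ⟨J, ?_, ?_⟩
    · rw [← Finset.card_pos, hJ]; exact List.length_pos_iff.2 hsuf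
    · rw [hcentre, hJ, hJs]
      congr 1
      have := map_list_sum (AddMonoidHom.fst (Pt d) (Fin n → Pt d)) (suf.map O.answer)
      simpa [List.map_map, Function.comp_def] using this

end SIB

theorem theorem3 :
    ∃ P : SIB.Prog, ∀ c : ℝ, 0 ≤ c → ∃ C : ℝ, 0 < C ∧
      ∀ (n d : ℕ) (Ω : Fin n → Set (SIB.Pt d)),
        (∀ i, (Ω i).Nonempty) → (∀ i, IsCompact (Ω i)) → (∀ i, Convex ℝ (Ω i)) →
        0 < SIB.optRadius Ω →
        ∀ (O : SIB.Subroutine n d) (S : ℝ), 0 ≤ S →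
          (∀ y ∈ SIB.maxSet n d,
            SIB.IsBestResponse Ω y (O.answer y) ∧ (O.time y : ℝ) ≤ c * S) →
          ∀ ε : ℝ, 0 < ε → ε ≤ 1 →
            ∃ (σ : SIB.State) (L : List (SIB.MaxVec n d)) (t : ℕ),
              SIB.Exec O P (SIB.initial n d ε) σ L t ∧
              SIB.IsApproxSolution Ω ε (σ.outCentre d) σ.outRadius ∧
              (t : ℝ) ≤ C * ((Metric.diam (⋃ i, Ω i) / SIB.optRadius Ω) ^ 2 *
                (S + n * d) * Real.log n / ε ^ 2) ∧
              (∀ y ∈ L, y ∈ SIB.maxSet n d) ∧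
              ∃ J : Finset (Fin L.length), J.Nonempty ∧
                σ.outCentre d = (J.card : ℝ)⁻¹ • ∑ k ∈ J, (O.answer (L.get k)).1 :=
  ⟨SIB.intersectingBallProg, fun c hc => ⟨10 ^ 6 + 10 ^ 4 * c, by positivity,
    fun _ _ _ hne hcomp hconv hr _ _ hS hO _ hε hε1 =>
      SIB.intersectingBallProg_exec hc hne hcomp hconv hr hS hO hε hε1⟩⟩
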